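/- Let $n\ge 6$ be an even integer, let $\varphi:\mathbb{R}^n\to\mathbb{R}$ be a polynomial with $\varphi\le 0$ on $\mathbb{R}^n$, and put $Q=(n-1)!+\varphi$. If $4\le\deg\varphi\le n-2$, assume in addition that, up to a rotation or a translation of the coordinates, $x\cdot\nabla\varphi\ge(\deg\varphi)\varphi$; that is, there is an isometry $T$ of $\mathbb{R}^n$ such that $\psi=\varphi\circ T$ satisfies $$x\cdot\nabla\psi(x)\ \ge\ (\deg\varphi)\,\psi(x)\qquad\text{for all }x\in\mathbb{R}^n .$$ Let $u\in C^\infty(\mathbb{R}^n)$ be a normal solution of $(-\Delta)^{n/2}u=Qe^{nu}$ on $\mathbb{R}^n$; that is, $Qe^{nu}\in L^1(\mathbb{R}^n)$, $u$ satisfies this equation, and for some constant $C\in\mathbb{R}$ $$u(x)=\frac{2}{(n-1)!\,|\mathbb{S}^n|}\int_{\mathbb{R}^n}\log\frac{|y|}{|x-y|}\,Q(y)e^{nu(y)}\,dy+C\qquad\text{for all }x\in\mathbb{R}^n,$$ where $|\mathbb{S}^n|$ is the volume of the standard unit $n$-sphere. Then $$\int_{\mathbb{R}^n}e^{nu}\,dx\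 \ge\ |\mathbb{S}^n|$$ (the integral may be $+\infty$), and equality holds if and only if $\varphi\equiv 0$. -/

import Mathlib

open MeasureTheory
open scoped ContDiff Laplacian Gradient

namespace QCurvature

/-- Euclidean `n`-space, with its Euclidean norm. -/
abbrev Euc (n : ℕ) : Type := EuclideanSpace ℝ (Fin n)

/-- The total surface measure `|𝕊ⁿ|` of the unit sphere of `ℝⁿ⁺¹` (a finite number). -/
noncomputable def sphereVol (n : ℕ) : ENNReal :=
  (volume : Measure (Euc (n + 1))).toSphere Set.univ

/-- The polyharmonic operator `(-Δ)ᵏ`, as the `k`-th iterate of `f ↦ -Δ f`. -/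
noncomputable def negLaplacianPow {n : ℕ} (k : ℕ) (u : Euc n → ℝ) : Euc n → ℝ :=
  (fun f : Euc n → ℝ => -(Δ f))^[k] u

/-- `u` is a (smooth) normal solution, for the smooth Q-curvature `Q`, of
`(-Δ)^{n/2} u = Q e^{nu}` on `ℝⁿ` (`n` even): `Q e^{nu}` is integrable, the equation holds,
and `u(x) = 2 / ((n-1)! |𝕊ⁿ|) ∫ log (|y| / |x - y|) Q(y) e^{n u(y)} dy + C` for a constant `C`.
For fixed `x` the kernel `log (|y| / |x - y|)` is bounded off a compact set and locally integrable,
so the integrand is integrable as soon as `Q e^{nu}` is integrable and continuous. -/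
structure IsNormalSolution (n : ℕ) (Q u : Euc n → ℝ) : Prop where
  smooth_curvature : ContDiff ℝ ∞ Q
  smooth : ContDiff ℝ ∞ u
  integrable : Integrable (fun x => Q x * Real.exp (n * u x)) volume
  equation : ∀ x, negLaplacianPow (n / 2) u x = Q x * Real.exp (n * u x)
  normal : ∃ C : ℝ, ∀ x, u x =
    2 / ((Nat.factorial (n - 1) : ℝ) * (sphereVol n).toReal) *
      (∫ y, Real.log (‖y‖ / ‖x - y‖) * (Q y * Real.exp (n * u y))) + C

/-- The function on `ℝⁿ` given by a real polynomial in `n` variables. -/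
noncomputable def polyFun {n : ℕ} (p : MvPolynomial (Fin n) ℝ) (x : Euc n) : ℝ :=
  MvPolynomial.eval (fun i => x i) p

/-- After a rigid motion `T` of the coordinates, `ψ = φ ∘ T` satisfies
`x · ∇ψ(x) ≥ (deg φ) ψ(x)` for all `x`. -/
def HomogeneityCondition {n : ℕ} (φ : MvPolynomial (Fin n) ℝ) : Prop :=
  ∃ T : Euc n ≃ᵃⁱ[ℝ] Euc n, ∀ x : Euc n,
    (φ.totalDegree : ℝ) * polyFun φ (T x) ≤ inner ℝ x (∇ (fun z => polyFun φ (T z)) x)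

end QCurvature

/-!
Write `Λ = ∫ Q e^{nu}`, `Λ₁ = (n-1)! |𝕊ⁿ|`, `t = Λ / Λ₁`, `V = ∫ e^{nu}` and `k = deg φ`, so that
`(n-1)! V = Λ - ∫ φ e^{nu}`. If `t ≥ 1`, then `φ ≤ 0` gives `V ≥ |𝕊ⁿ|`, with equality only if
`∫ φ e^{nu} = 0`. It remains to see that `t < 1` forces `V > |𝕊ⁿ|`.

Only the integral representation of `u` is needed. Test it with the dilation field about a point
`p`, cut off at a large scale: symmetrising in `(x, y)` turns the singular kernel `∇ log |x - y|`
into a bounded one and yields a Pohozaev identity in the limit. If `φ` satisfies Euler's inequality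
of degree `k` about `p`, it reads `n Λ (t - 1) ≥ k ∫ φ e^{nu}`. On the other hand, the averages of
`u` over the balls `R • B` behave like `-2t log R`. Since `(1 - φ) e^{nu}` is integrable if `V < ∞`
and `1 - φ` grows like `R ^ k` along some cone, Jensen's inequality gives `n + k ≤ 2nt`. Combining
the two settles the case `t < 1`; for `φ = 0` the Pohozaev identity reads `t = 1`.

A nonpositive polynomial has even degree. In degrees `0` and `2` it satisfies Euler's inequality
about any point and about a critical point respectively; in degree `n` or more, `n + k ≤ 2nt`
already excludes `t < 1`.
-/

namespace QCurvature

open Metric Filter Topology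
open Module (finrank)
open scoped Real

/-! ### Logarithmic potentials -/

section NewtonKernel

variable {E : Type*} [NormedAddCommGroup E]

/-- The Newton kernel `1 / |z|`, truncated to the unit ball so as to be integrable. -/
noncomputable def truncNewton (z : E) : ℝ := (ball (0 : E) 1).indicator (fun z => ‖z‖⁻¹) z

lemma truncNewton_nonneg (z : E) : 0 ≤ truncNewton z :=
  Set.indicator_nonneg (fun _ _ => by positivity) z

lemma mul_norm_sub_inv_le {g : E → ℝ} {y : E} {M : ℝ} (hM : ∀ x ∈ ball y 1, |g x| ≤ M) (x : E) :
    |g x| * ‖x - y‖⁻¹ ≤ M * truncNewton (x - y) + |g x| := by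
  have hg : 0 ≤ |g x| := abs_nonneg _
  by_cases hx : ‖x - y‖ < 1
  · rw [truncNewton, Set.indicator_of_mem (mem_ball_zero_iff.2 hx)]
    have := hM x (mem_ball_iff_norm.2 hx)
    exact (mul_le_mul_of_nonneg_right this (by positivity)).trans (le_add_of_nonneg_right hg)
  · rw [truncNewton, Set.indicator_of_notMem (mt mem_ball_zero_iff.1 hx), mul_zero, zero_add]
    exact mul_le_of_le_one_right hg (inv_le_one_of_one_le₀ (not_lt.1 hx))

lemma norm_inv_le_truncNewton_add_one (z : E) : ‖z‖⁻¹ ≤ truncNewton z + 1 := by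
  simpa using mul_norm_sub_inv_le (g := fun _ => 1) (y := 0) (M := 1) (fun _ _ => abs_one.le) z

variable [NormedSpace ℝ E] [MeasurableSpace E] [BorelSpace E] [FiniteDimensional ℝ E]
  {μ : Measure E} [μ.IsAddHaarMeasure]

lemma ae_ne (hd : 0 < finrank ℝ E) (y : E) : ∀ᵐ x ∂μ, x ≠ y := by
  have := Module.nontrivial_of_finrank_pos hd
  simp [ae_iff]

lemma ae_fst_ne_snd (hd : 0 < finrank ℝ E) : ∀ᵐ q : E × E ∂μ.prod μ, q.1 ≠ q.2 :=
  (Measure.ae_prod_iff_ae_ae (measurableSet_eq_fun measurable_fst measurable_snd).compl).2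
    (ae_of_all _ fun x => (ae_ne hd x).mono fun _ => Ne.symm)

lemma integrable_truncNewton (hd : 2 ≤ finrank ℝ E) : Integrable (truncNewton (E := E)) μ := by
  have := Module.nontrivial_of_finrank_pos (two_pos.trans_le hd)
  refine (integrable_indicator_iff measurableSet_ball).2 ?_
  rw [integrableOn_fun_norm_addHaar μ (f := fun r : ℝ => r⁻¹)]
  obtain ⟨k, hk⟩ := Nat.exists_eq_add_of_le' hd
  have hpow : IntegrableOn (fun r : ℝ => r ^ k) (Set.Ioo 0 1) :=
    (continuous_pow k).integrableOn_Icc.mono_set Set.Ioo_subset_Icc_self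
  refine hpow.congr_fun (fun r hr => ?_) measurableSet_Ioo
  have : r ≠ 0 := hr.1.ne'
  simp only [hk, show k + 2 - 1 = k + 1 by omega, pow_succ, smul_eq_mul]
  field_simp

lemma integrable_mul_norm_sub_inv (hd : 2 ≤ finrank ℝ E) {g : E → ℝ} (hg : Integrable g μ)
    (hgc : Continuous g) (y : E) : Integrable (fun x => g x * ‖x - y‖⁻¹) μ := by
  obtain ⟨M, hM⟩ := (isCompact_closedBall y 1).exists_bound_of_continuousOn hgc.continuousOn
  have hdom : Integrable (fun x => M * truncNewton (x - y) + |g x|) μ :=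
    (((integrable_truncNewton hd).comp_sub_right y).const_mul M).add hg.abs
  refine hdom.mono' (hg.aestronglyMeasurable.mul
    (by fun_prop : Measurable fun x : E => ‖x - y‖⁻¹).aestronglyMeasurable)
    (ae_of_all _ fun x => ?_)
  simpa [abs_mul] using mul_norm_sub_inv_le (fun z hz => hM z (ball_subset_closedBall hz)) x

lemma integrable_mul_norm_inv (hd : 2 ≤ finrank ℝ E) {g : E → ℝ} (hg : Integrable g μ)
    (hgc : Continuous g) : Integrable (fun x => g x * ‖x‖⁻¹) μ := by
  simpa only [sub_zero] using integrable_mul_norm_sub_inv hd hg hgc 0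

lemma integrable_prod_mul_norm_sub_inv (hd : 2 ≤ finrank ℝ E) {f g : E → ℝ} (hf : Integrable f μ)
    (hg : Integrable g μ) {M : ℝ} (hM : ∀ x, |g x| ≤ M) :
    Integrable (fun q : E × E => g q.1 * f q.2 * ‖q.1 - q.2‖⁻¹) (μ.prod μ) := by
  have hconv : Integrable (fun q : E × E => |f q.2| * truncNewton (q.1 - q.2)) (μ.prod μ) :=
    hf.abs.convolution_integrand (ContinuousLinearMap.mul ℝ ℝ) (integrable_truncNewton hd)
  refine ((hconv.const_mul M).add (hg.mul_prod hf).abs).mono'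
    ((hg.aestronglyMeasurable.comp_fst.mul hf.aestronglyMeasurable.comp_snd).mul
      (by fun_prop : Measurable fun q : E × E => ‖q.1 - q.2‖⁻¹).aestronglyMeasurable)
    (ae_of_all _ fun q => ?_)
  have := mul_le_mul_of_nonneg_left
    (mul_norm_sub_inv_le (y := q.2) (fun x _ => hM x) q.1) (abs_nonneg (f q.2))
  simp only [Pi.add_apply, norm_mul, norm_inv, Real.norm_eq_abs, abs_norm, abs_mul]
  linarith

lemma integrableOn_norm_sub_inv (hd : 2 ≤ finrank ℝ E) {B : Set E} (hB : μ B ≠ ⊤) (y : E) :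
    IntegrableOn (fun x => ‖x - y‖⁻¹) B μ := by
  have hdom : IntegrableOn (fun x => truncNewton (x - y) + 1) B μ :=
    ((integrable_truncNewton hd).comp_sub_right y).integrableOn.add (integrableOn_const hB)
  refine hdom.mono' (by fun_prop : Measurable fun x : E => ‖x - y‖⁻¹).aestronglyMeasurable
    (ae_of_all _ fun x => ?_)
  simpa using norm_inv_le_truncNewton_add_one (x - y)

lemma setIntegral_norm_sub_inv_le (hd : 2 ≤ finrank ℝ E) {B : Set E} (hB : μ B ≠ ⊤) (y : E) :
    ∫ x in B, ‖x - y‖⁻¹ ∂μ ≤ (∫ x, truncNewton x ∂μ) + μ.real B := by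
  have htr := (integrable_truncNewton (μ := μ) hd).comp_sub_right y
  have hone : IntegrableOn (fun _ => (1 : ℝ)) B μ := integrableOn_const hB
  calc ∫ x in B, ‖x - y‖⁻¹ ∂μ ≤ ∫ x in B, (truncNewton (x - y) + 1) ∂μ :=
        integral_mono (integrableOn_norm_sub_inv hd hB y) (htr.integrableOn.add hone)
          fun x => norm_inv_le_truncNewton_add_one _
    _ = (∫ x in B, truncNewton (x - y) ∂μ) + μ.real B := by
        rw [integral_add htr.integrableOn hone, setIntegral_const, smul_eq_mul, mul_one]
    _ ≤ (∫ x, truncNewton (x - y) ∂μ) + μ.real B :=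
        add_le_add_left (setIntegral_le_integral htr (ae_of_all _ fun x => truncNewton_nonneg _)) _
    _ = (∫ x, truncNewton x ∂μ) + μ.real B := by rw [integral_sub_right_eq_self]

end NewtonKernel

lemma abs_log_le {r : ℝ} (hr : 0 ≤ r) : |Real.log r| ≤ r + r⁻¹ := by
  rcases hr.eq_or_lt with rfl | hr
  · simp
  have hinv := inv_pos.2 hr
  have hlog := Real.log_le_sub_one_of_pos hr
  have hlog_inv := Real.log_le_sub_one_of_pos hinv
  rw [Real.log_inv] at hlog_inv
  rw [abs_le]
  constructor <;> linarith

lemma abs_log_div_le {a b : ℝ} (ha : 0 ≤ a) (hb : 0 ≤ b) :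
    |Real.log (a / b)| ≤ |a - b| * (a⁻¹ + b⁻¹) := by
  rcases ha.eq_or_lt with rfl | ha
  · simp only [zero_div, Real.log_zero, abs_zero]; positivity
  rcases hb.eq_or_lt with rfl | hb
  · simp only [div_zero, Real.log_zero, abs_zero]; positivity
  have log_div_le : ∀ {a b : ℝ}, 0 < a → 0 < b →
      Real.log (a / b) ≤ |a - b| * (a⁻¹ + b⁻¹) := fun {a b} ha hb =>
    calc Real.log (a / b) ≤ a / b - 1 := Real.log_le_sub_one_of_pos (div_pos ha hb)
      _ = (a - b) * b⁻¹ := by field_simp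
      _ ≤ |a - b| * (a⁻¹ + b⁻¹) := mul_le_mul (le_abs_self _)
          (le_add_of_nonneg_left (by positivity)) (by positivity) (abs_nonneg _)
  refine abs_le'.2 ⟨log_div_le ha hb, ?_⟩
  rw [← Real.log_inv, inv_div, abs_sub_comm, add_comm]
  exact log_div_le hb ha

section LogPotential

variable {E : Type*} [NormedAddCommGroup E]

/-- The kernel `log (|y| / |x - y|)` of the normalised logarithmic potential. -/
noncomputable def logKernel (x y : E) : ℝ := Real.log (‖y‖ / ‖x - y‖)

lemma abs_logKernel_le (x y : E) : |logKernel x y| ≤ ‖x‖ * (‖y‖⁻¹ + ‖x - y‖⁻¹) := by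
  refine (abs_log_div_le (norm_nonneg _) (norm_nonneg _)).trans ?_
  gcongr
  simpa [norm_sub_rev x y] using abs_norm_sub_norm_le y (y - x)

variable [MeasurableSpace E]

/-- The logarithmic potential `∫ log (|y| / |x - y|) f(y) dμ(y)` of a density `f`. -/
noncomputable def logPotential (μ : Measure E) (f : E → ℝ) (x : E) : ℝ :=
  ∫ y, logKernel x y * f y ∂μ

variable [NormedSpace ℝ E] [BorelSpace E] [FiniteDimensional ℝ E]

lemma measurable_logKernel : Measurable fun q : E × E => logKernel q.1 q.2 := by
  unfold logKernel
  fun_prop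

variable {μ : Measure E} [μ.IsAddHaarMeasure]

lemma integrable_log_norm_sub_mul (hd : 2 ≤ finrank ℝ E) {D : E → ℝ} (hD : Continuous D)
    (hDs : HasCompactSupport D) (y : E) : Integrable (fun x => Real.log ‖x - y‖ * D x) μ := by
  have hfar : Integrable (fun x => |D x| * ‖x - y‖) μ :=
    Continuous.integrable_of_hasCompactSupport (by fun_prop) hDs.norm.mul_right
  have hnear : Integrable (fun x => |D x| * ‖x - y‖⁻¹) μ := integrable_mul_norm_sub_inv hd
    (hD.integrable_of_hasCompactSupport hDs).abs hD.abs y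
  refine (hfar.add hnear).mono' ((by fun_prop : Measurable fun x : E =>
    Real.log ‖x - y‖).aestronglyMeasurable.mul hD.aestronglyMeasurable) (ae_of_all _ fun x => ?_)
  have := mul_le_mul_of_nonneg_left (abs_log_le (norm_nonneg (x - y))) (abs_nonneg (D x))
  simp only [Pi.add_apply, norm_mul, Real.norm_eq_abs]
  linarith

lemma integrable_prod_logKernel (hd : 2 ≤ finrank ℝ E) {f g : E → ℝ} (hf : Integrable f μ)
    (hfc : Continuous f) (hg : AEStronglyMeasurable g μ)
    (hgi : Integrable (fun x => ‖x‖ * g x) μ) {M : ℝ} (hM : ∀ x, |‖x‖ * g x| ≤ M) :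
    Integrable (fun q : E × E => g q.1 * (logKernel q.1 q.2 * f q.2)) (μ.prod μ) := by
  refine ((hgi.mul_prod (integrable_mul_norm_inv hd hf hfc)).norm.add
    (integrable_prod_mul_norm_sub_inv hd hf hgi hM).norm).mono'
    (hg.comp_fst.mul (measurable_logKernel.aestronglyMeasurable.mul
      hf.aestronglyMeasurable.comp_snd)) (ae_of_all _ fun q => ?_)
  have := mul_le_mul_of_nonneg_left (abs_logKernel_le q.1 q.2)
    (mul_nonneg (abs_nonneg (g q.1)) (abs_nonneg (f q.2)))
  simp only [Pi.add_apply, norm_mul, norm_inv, Real.norm_eq_abs, abs_norm]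
  linarith

lemma integral_logPotential_mul (hd : 2 ≤ finrank ℝ E) {f g : E → ℝ} (hf : Integrable f μ)
    (hfc : Continuous f) (hg : AEStronglyMeasurable g μ)
    (hgi : Integrable (fun x => ‖x‖ * g x) μ) {M : ℝ} (hM : ∀ x, |‖x‖ * g x| ≤ M) :
    ∫ x, logPotential μ f x * g x ∂μ = ∫ y, f y * ∫ x, logKernel x y * g x ∂μ ∂μ := by
  calc ∫ x, logPotential μ f x * g x ∂μ
      = ∫ x, ∫ y, g x * (logKernel x y * f y) ∂μ ∂μ := by
        simp only [logPotential, integral_const_mul, mul_comm]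
    _ = ∫ y, ∫ x, g x * (logKernel x y * f y) ∂μ ∂μ :=
        integral_integral_swap (integrable_prod_logKernel hd hf hfc hg hgi hM)
    _ = ∫ y, f y * ∫ x, logKernel x y * g x ∂μ ∂μ := by
        simp only [← integral_const_mul, mul_comm, mul_left_comm]

end LogPotential

/-! ### Decay of ball averages -/

section BallAverage

variable {E : Type*} [NormedAddCommGroup E]

lemma abs_logKernel_add_posLog_le {z w : E} {S : ℝ} (hz : ‖z‖ ≤ S) (hzw : z ≠ w) :
    |logKernel z w + log⁺ ‖w‖⁻¹| ≤ (S + 1) * (1 + ‖z - w‖⁻¹) := by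
  have ha : 0 < ‖z - w‖ := norm_sub_pos_iff.2 hzw
  have hS : 0 ≤ S := (norm_nonneg z).trans hz
  rcases eq_or_ne w 0 with rfl | hw
  · simp only [logKernel, norm_zero, zero_div, Real.log_zero, inv_zero, Real.posLog_zero, add_zero,
      abs_zero]
    positivity
  have hlog : logKernel z w + log⁺ ‖w‖⁻¹ = Real.log (max 1 ‖w‖ / ‖z - w‖) := by
    rw [logKernel, Real.log_div (norm_ne_zero_iff.2 hw) ha.ne', Real.log_div (by positivity) ha.ne',
      ← Real.posLog_eq_log_max_one (norm_nonneg w), ← Real.posLog_sub_posLog_inv (x := ‖w‖)]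
    ring
  have hw_le : ‖w‖ ≤ S + ‖z - w‖ := by
    have := norm_sub_norm_le w z
    rw [norm_sub_rev] at this
    linarith
  have ha_le : ‖z - w‖ ≤ (S + 1) * max 1 ‖w‖ := by
    nlinarith [norm_sub_le z w, le_max_left 1 ‖w‖, le_max_right 1 ‖w‖]
  rw [hlog, abs_le']
  constructor
  · calc Real.log (max 1 ‖w‖ / ‖z - w‖) ≤ max 1 ‖w‖ / ‖z - w‖ :=
          Real.log_le_self (by positivity)
      _ ≤ (S + 1 + ‖z - w‖) / ‖z - w‖ := by gcongr; exact max_le (by linarith) (by linarith)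
      _ = (S + 1) * ‖z - w‖⁻¹ + 1 := by field_simp
      _ ≤ (S + 1) * (1 + ‖z - w‖⁻¹) := by linarith
  · calc -Real.log (max 1 ‖w‖ / ‖z - w‖) = Real.log (‖z - w‖ / max 1 ‖w‖) := by
          rw [← Real.log_inv, inv_div]
      _ ≤ ‖z - w‖ / max 1 ‖w‖ := Real.log_le_self (by positivity)
      _ ≤ S + 1 := (div_le_iff₀ (by positivity)).2 ha_le
      _ ≤ (S + 1) * (1 + ‖z - w‖⁻¹) := le_mul_of_one_le_right (by linarith)
          (le_add_of_nonneg_right (by positivity))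

variable [NormedSpace ℝ E] [MeasurableSpace E] [BorelSpace E] [FiniteDimensional ℝ E]
  {μ : Measure E} [μ.IsAddHaarMeasure]

lemma integrableOn_logKernel (hd : 2 ≤ finrank ℝ E) {B : Set E} (hB : Bornology.IsBounded B)
    (hBm : MeasurableSet B) (w : E) : IntegrableOn (fun z => logKernel z w) B μ := by
  obtain ⟨S, hS⟩ := hB.exists_norm_le
  have hBfin : μ B ≠ ⊤ := hB.measure_lt_top.ne
  have hdom : IntegrableOn (fun z => S * (‖w‖⁻¹ + ‖z - w‖⁻¹)) B μ :=
    ((integrableOn_const hBfin).add (integrableOn_norm_sub_inv hd hBfin w)).const_mul S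
  refine hdom.mono' (measurable_logKernel.comp measurable_prodMk_right).aestronglyMeasurable ?_
  filter_upwards [ae_restrict_mem hBm] with z hz
  exact (abs_logKernel_le z w).trans (by gcongr; exact hS z hz)

lemma exists_abs_setAverage_logKernel_le (hd : 2 ≤ finrank ℝ E) {B : Set E}
    (hB : Bornology.IsBounded B) (hBm : MeasurableSet B) (hB0 : μ B ≠ 0) :
    ∃ K, ∀ w, |(⨍ z in B, logKernel z w ∂μ) + log⁺ ‖w‖⁻¹| ≤ K := by
  obtain ⟨S, hS0, hS⟩ := hB.exists_pos_norm_le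
  have hBfin : μ B ≠ ⊤ := hB.measure_lt_top.ne
  have hBpos : 0 < μ.real B := ENNReal.toReal_pos hB0 hBfin
  refine ⟨(μ.real B)⁻¹ * ((S + 1) *
    (μ.real B + ((∫ x, truncNewton x ∂μ) + μ.real B))), fun w => ?_⟩
  have hone : IntegrableOn (fun _ => (1 : ℝ)) B μ := integrableOn_const hBfin
  have hinv := integrableOn_norm_sub_inv (μ := μ) hd hBfin w
  have havg : (⨍ z in B, logKernel z w ∂μ) + log⁺ ‖w‖⁻¹ =
      (μ.real B)⁻¹ * ∫ z in B, (logKernel z w + log⁺ ‖w‖⁻¹) ∂μ := by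
    rw [integral_add (integrableOn_logKernel hd hB hBm w) (integrableOn_const hBfin),
      setIntegral_const, setAverage_eq, smul_eq_mul, smul_eq_mul]
    field_simp
  rw [havg, abs_mul, abs_of_pos (inv_pos.2 hBpos)]
  gcongr
  calc |∫ z in B, (logKernel z w + log⁺ ‖w‖⁻¹) ∂μ|
      ≤ ∫ z in B, (S + 1) * (1 + ‖z - w‖⁻¹) ∂μ := by
        rw [← Real.norm_eq_abs]
        refine norm_integral_le_of_norm_le ((hone.add hinv).const_mul (S + 1)) ?_
        filter_upwards [ae_restrict_mem hBm, ae_restrict_of_ae (ae_ne (two_pos.trans_le hd) w)]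
          with z hz hzw
        exact abs_logKernel_add_posLog_le (hS z hz) hzw
    _ = (S + 1) * (μ.real B + ∫ z in B, ‖z - w‖⁻¹ ∂μ) := by
        rw [integral_const_mul, integral_add hone hinv, setIntegral_const, smul_eq_mul, mul_one]
    _ ≤ _ := by
        gcongr
        exact setIntegral_norm_sub_inv_le hd hBfin w

lemma setAverage_logPotential (hd : 2 ≤ finrank ℝ E) {f : E → ℝ} (hf : Integrable f μ)
    (hfc : Continuous f) {B : Set E} (hB : Bornology.IsBounded B) (hBm : MeasurableSet B) :
    ⨍ z in B, logPotential μ f z ∂μ = ∫ w, f w * ⨍ z in B, logKernel z w ∂μ ∂μ := by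
  obtain ⟨S, hS⟩ := hB.exists_norm_le
  have hle : ∀ x, |‖x‖ * B.indicator (fun _ => 1) x| ≤ |S| := fun x => by
    by_cases hx : x ∈ B
    · simpa [hx] using (hS x hx).trans (le_abs_self S)
    · simp [hx]
  have hind : Integrable (B.indicator fun _ => (1 : ℝ)) μ :=
    (integrable_indicator_iff hBm).2 (integrableOn_const hB.measure_lt_top.ne)
  have hnorm : Integrable (fun x => ‖x‖ * B.indicator (fun _ => 1) x) μ := by
    refine (hind.const_mul |S|).mono'
      (continuous_norm.aestronglyMeasurable.mul hind.aestronglyMeasurable) (ae_of_all _ fun x => ?_)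
    by_cases hx : x ∈ B
    · simpa [hx] using hle x
    · simp [hx]
  have hset : ∀ g : E → ℝ,
      ∫ x, g x * B.indicator (fun _ => 1) x ∂μ = ∫ x in B, g x ∂μ := fun g => by
    rw [← integral_indicator hBm]
    congr 1 with x
    by_cases hx : x ∈ B <;> simp [hx]
  have := integral_logPotential_mul hd hf hfc hind.aestronglyMeasurable hnorm hle
  simp only [hset] at this
  simp only [setAverage_eq, smul_eq_mul, this, mul_left_comm (f _), integral_const_mul]

lemma posLog_le_self {r : ℝ} (hr : 0 ≤ r) : log⁺ r ≤ r := max_le hr (Real.log_le_self hr)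

lemma integrable_mul_posLog (hd : 2 ≤ finrank ℝ E) {f : E → ℝ} (hf : Integrable f μ)
    (hfc : Continuous f) : Integrable (fun w => f w * log⁺ ‖w‖⁻¹) μ := by
  refine (integrable_mul_norm_inv hd hf.abs hfc.abs).mono' (hfc.measurable.mul
    (Real.continuous_posLog.measurable.comp (by fun_prop))).aestronglyMeasurable
    (ae_of_all _ fun w => ?_)
  rw [norm_mul, Real.norm_of_nonneg Real.posLog_nonneg, Real.norm_eq_abs]
  gcongr
  exact posLog_le_self (by positivity)

lemma exists_abs_setAverage_logPotential_le (hd : 2 ≤ finrank ℝ E) {B : Set E}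
    (hB : Bornology.IsBounded B) (hBm : MeasurableSet B) (hB0 : μ B ≠ 0) :
    ∃ K, ∀ f : E → ℝ, Integrable f μ → Continuous f →
      |(⨍ z in B, logPotential μ f z ∂μ) + ∫ w, f w * log⁺ ‖w‖⁻¹ ∂μ| ≤ K * ∫ w, |f w| ∂μ := by
  obtain ⟨K, hK⟩ := exists_abs_setAverage_logKernel_le (μ := μ) hd hB hBm hB0
  refine ⟨K, fun f hf hfc => ?_⟩
  have hle : ∀ w, ‖f w * ((⨍ z in B, logKernel z w ∂μ) + log⁺ ‖w‖⁻¹)‖ ≤ K * |f w| := fun w => by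
    rw [norm_mul, mul_comm K]
    exact mul_le_mul_of_nonneg_left (hK w) (abs_nonneg _)
  have hmeas : AEStronglyMeasurable (fun w => ⨍ z in B, logKernel z w ∂μ) μ := by
    simp only [setAverage_eq, smul_eq_mul]
    exact (measurable_logKernel.stronglyMeasurable.integral_prod_left
      (μ := μ.restrict B)).aestronglyMeasurable.const_mul _
  have hdom : Integrable (fun w => K * |f w|) μ := hf.abs.const_mul K
  have hint : Integrable (fun w => f w * ((⨍ z in B, logKernel z w ∂μ) + log⁺ ‖w‖⁻¹)) μ :=
    hdom.mono' (hf.aestronglyMeasurable.mul (hmeas.add (Real.continuous_posLog.measurable.comp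
      (by fun_prop)).aestronglyMeasurable)) (ae_of_all _ hle)
  have hlog := integrable_mul_posLog hd hf hfc
  have hsum : (⨍ z in B, logPotential μ f z ∂μ) + ∫ w, f w * log⁺ ‖w‖⁻¹ ∂μ =
      ∫ w, f w * ((⨍ z in B, logKernel z w ∂μ) + log⁺ ‖w‖⁻¹) ∂μ := by
    rw [setAverage_logPotential hd hf hfc hB hBm, ← integral_add ?_ hlog]
    · simp only [mul_add]
    · exact (hint.sub hlog).congr (ae_of_all _ fun w => by simp only [Pi.sub_apply]; ring)
  rw [hsum, ← integral_const_mul]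
  exact norm_integral_le_of_norm_le hdom (ae_of_all _ hle)

lemma integral_pow_mul_comp_smul (F : E → ℝ) {R : ℝ} (hR : 0 < R) :
    ∫ w, R ^ finrank ℝ E * F (R • w) ∂μ = ∫ y, F y ∂μ := by
  rw [integral_const_mul, Measure.integral_comp_smul_of_nonneg μ F R (hR := hR.le), smul_eq_mul,
    mul_inv_cancel_left₀ (by positivity)]

lemma logPotential_smul (f : E → ℝ) {R : ℝ} (hR : 0 < R) (z : E) :
    logPotential μ f (R • z) = logPotential μ (fun w => R ^ finrank ℝ E * f (R • w)) z := by
  rw [logPotential, ← integral_pow_mul_comp_smul _ hR, logPotential]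
  congr 1 with w
  rw [logKernel, ← smul_sub, norm_smul, norm_smul, mul_div_mul_left _ _ (norm_ne_zero_iff.2 hR.ne'),
    ← logKernel]
  ring

lemma exists_abs_setAverage_logPotential_smul_le (hd : 2 ≤ finrank ℝ E) {f : E → ℝ}
    (hf : Integrable f μ) (hfc : Continuous f) {B : Set E}
    (hB : Bornology.IsBounded B) (hBm : MeasurableSet B) (hB0 : μ B ≠ 0) :
    ∃ K, ∀ R > 0,
      |(⨍ z in B, logPotential μ f (R • z) ∂μ) + ∫ y, f y * log⁺ (R * ‖y‖⁻¹) ∂μ| ≤ K := by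
  obtain ⟨K, hK⟩ := exists_abs_setAverage_logPotential_le (μ := μ) hd hB hBm hB0
  refine ⟨K * ∫ y, |f y| ∂μ, fun R hR => ?_⟩
  have hbound := hK (fun w => R ^ finrank ℝ E * f (R • w)) ((hf.comp_smul hR.ne').const_mul _)
    (by fun_prop)
  have hmass : ∫ w, |R ^ finrank ℝ E * f (R • w)| ∂μ = ∫ y, |f y| ∂μ := by
    rw [← integral_pow_mul_comp_smul (fun y => |f y|) hR]
    simp only [abs_mul, abs_of_pos (pow_pos hR _)]
  have hlog : ∫ w, R ^ finrank ℝ E * f (R • w) * log⁺ ‖w‖⁻¹ ∂μ =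
      ∫ y, f y * log⁺ (R * ‖y‖⁻¹) ∂μ := by
    rw [← integral_pow_mul_comp_smul (fun y => f y * log⁺ (R * ‖y‖⁻¹)) hR]
    congr 1 with w
    rw [norm_smul, Real.norm_of_nonneg hR.le, mul_inv, mul_inv_cancel_left₀ hR.ne', mul_assoc]
  simpa only [hmass, hlog, logPotential_smul f hR] using hbound

lemma tendsto_posLog_mul_div_log {b : ℝ} (hb : 0 < b) :
    Tendsto (fun R => log⁺ (R * b) / Real.log R) atTop (𝓝 1) := by
  have hlim : Tendsto (fun R => 1 + Real.log b / Real.log R) atTop (𝓝 1) := by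
    simpa using (Real.tendsto_log_atTop.const_div_atTop (Real.log b)).const_add 1
  refine hlim.congr' ?_
  filter_upwards [eventually_gt_atTop 1, eventually_ge_atTop b⁻¹] with R hR hRb
  have hone : 1 ≤ R * b := (inv_le_iff_one_le_mul₀ hb).1 hRb
  have hlog : Real.log R ≠ 0 := (Real.log_pos hR).ne'
  rw [Real.posLog_eq_log (hone.trans (le_abs_self _)), Real.log_mul (by positivity) hb.ne']
  field_simp

lemma tendsto_integral_mul_posLog_div_log (hd : 2 ≤ finrank ℝ E) {f : E → ℝ}
    (hf : Integrable f μ) (hfc : Continuous f) :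
    Tendsto (fun R => (∫ y, f y * log⁺ (R * ‖y‖⁻¹) ∂μ) / Real.log R) atTop (𝓝 (∫ y, f y ∂μ)) := by
  simp only [← integral_div, mul_div_assoc]
  refine tendsto_integral_filter_of_dominated_convergence (fun y => |f y| + |f y| * ‖y‖⁻¹)
    (Eventually.of_forall fun R => (hfc.measurable.mul ((Real.continuous_posLog.measurable.comp
      (by fun_prop)).div_const _)).aestronglyMeasurable) ?_
    (hf.abs.add (integrable_mul_norm_inv hd hf.abs hfc.abs)) ?_
  · filter_upwards [eventually_ge_atTop (Real.exp 1)] with R hR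
    have hR1 : 1 ≤ R := (Real.one_le_exp zero_le_one).trans hR
    have hlog : 1 ≤ Real.log R := (Real.le_log_iff_exp_le (by positivity)).2 hR
    refine ae_of_all _ fun y => ?_
    rw [norm_mul, norm_div, Real.norm_of_nonneg Real.posLog_nonneg, ← mul_one_add,
      Real.norm_of_nonneg (zero_le_one.trans hlog), Real.norm_eq_abs]
    gcongr
    rw [div_le_iff₀ (by positivity)]
    calc log⁺ (R * ‖y‖⁻¹) ≤ log⁺ R + log⁺ ‖y‖⁻¹ := Real.posLog_mul
      _ ≤ Real.log R + ‖y‖⁻¹ * Real.log R := by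
          rw [Real.posLog_eq_log (hR1.trans (le_abs_self R))]
          gcongr
          exact (posLog_le_self (by positivity)).trans (le_mul_of_one_le_right (by positivity) hlog)
      _ = (1 + ‖y‖⁻¹) * Real.log R := by ring
  · filter_upwards [ae_ne (two_pos.trans_le hd) 0] with y hy
    simpa using (tendsto_posLog_mul_div_log (inv_pos.2 (norm_pos_iff.2 hy))).const_mul (f y)

theorem tendsto_setAverage_logPotential_div_log (hd : 2 ≤ finrank ℝ E) {f : E → ℝ}
    (hf : Integrable f μ) (hfc : Continuous f) {B : Set E}
    (hB : Bornology.IsBounded B) (hBm : MeasurableSet B) (hB0 : μ B ≠ 0) :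
    Tendsto (fun R : ℝ => (⨍ z in B, logPotential μ f (R • z) ∂μ) / Real.log R) atTop
      (𝓝 (-∫ y, f y ∂μ)) := by
  obtain ⟨K, hK⟩ := exists_abs_setAverage_logPotential_smul_le hd hf hfc hB hBm hB0
  have hrem : Tendsto (fun R : ℝ => ((⨍ z in B, logPotential μ f (R • z) ∂μ) +
      ∫ y, f y * log⁺ (R * ‖y‖⁻¹) ∂μ) / Real.log R) atTop (𝓝 0) := by
    refine squeeze_zero_norm' ?_ (Real.tendsto_log_atTop.const_div_atTop K)
    filter_upwards [eventually_gt_atTop 1] with R hR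
    rw [norm_div, Real.norm_of_nonneg (Real.log_pos hR).le]
    have := Real.log_pos hR
    gcongr
    exact hK R (by positivity)
  simpa [add_div] using hrem.sub (tendsto_integral_mul_posLog_div_log hd hf hfc)

end BallAverage

section Decay

variable {E : Type*} [NormedAddCommGroup E] [NormedSpace ℝ E]

/-- `w` grows at least like `R ^ k` along the cone over some ball, uniformly in that ball. -/
def HasConeGrowth (w : E → ℝ) (k : ℕ) : Prop :=
  ∃ q : E, ∃ ρ > 0, ∃ κ > 0, ∀ᶠ R : ℝ in atTop, ∀ z ∈ closedBall q ρ, κ * R ^ k ≤ w (R • z)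

variable [MeasurableSpace E]

/-- `u` is, up to an additive constant, `c` times the logarithmic potential of its own curvature
density `Q e^{αu}`, the latter being integrable. Normal solutions of the `Q`-curvature equation on
`ℝⁿ` are the case `α = n`, `c = 2 / ((n - 1)! |𝕊ⁿ|)`. -/
structure IsLogSolution (μ : Measure E) (c α : ℝ) (Q u : E → ℝ) : Prop where
  contDiff_curvature : ContDiff ℝ 1 Q
  contDiff : ContDiff ℝ 1 u
  integrable : Integrable (fun x => Q x * Real.exp (α * u x)) μ
  exists_const : ∃ C : ℝ, ∀ x, u x = c * logPotential μ (fun y => Q y * Real.exp (α * u y)) x + C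

variable {μ : Measure E} {c α : ℝ} {Q u w : E → ℝ}

lemma IsLogSolution.contDiff_exp (hu : IsLogSolution μ c α Q u) :
    ContDiff ℝ 1 fun x => Real.exp (α * u x) :=
  (contDiff_const.mul hu.contDiff).exp

lemma IsLogSolution.contDiff_density (hu : IsLogSolution μ c α Q u) :
    ContDiff ℝ 1 fun x => Q x * Real.exp (α * u x) :=
  hu.contDiff_curvature.mul hu.contDiff_exp

variable [BorelSpace E] [FiniteDimensional ℝ E] [μ.IsAddHaarMeasure]

lemma IsLogSolution.tendsto_setAverage_div_log (hd : 2 ≤ finrank ℝ E)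
    (hu : IsLogSolution μ c α Q u) {B : Set E} (hB : IsCompact B) (hB0 : μ B ≠ 0) :
    Tendsto (fun R : ℝ => (⨍ z in B, u (R • z) ∂μ) / Real.log R) atTop
      (𝓝 (-(c * ∫ y, Q y * Real.exp (α * u y) ∂μ))) := by
  obtain ⟨C, hC⟩ := hu.exists_const
  set f := fun y => Q y * Real.exp (α * u y)
  have hlim : Tendsto (fun R : ℝ => c * ((⨍ z in B, logPotential μ f (R • z) ∂μ) / Real.log R) +
      C / Real.log R) atTop (𝓝 (c * -(∫ y, f y ∂μ) + 0)) :=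
    ((tendsto_setAverage_logPotential_div_log hd hu.integrable hu.contDiff_density.continuous
      hB.isBounded hB.measurableSet hB0).const_mul c).add
      (Real.tendsto_log_atTop.const_div_atTop C)
  rw [add_zero, mul_neg] at hlim
  refine hlim.congr fun R => ?_
  have hBfin : μ B ≠ ⊤ := hB.measure_lt_top.ne
  have hB_pos : μ.real B ≠ 0 := (ENNReal.toReal_pos hB0 hBfin).ne'
  have hint : IntegrableOn (fun z => u (R • z) - C) B μ :=
    ((hu.contDiff.continuous.comp (continuous_const_smul R)).sub
      continuous_const).continuousOn.integrableOn_compact hB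
  have hsplit : ∫ z in B, u (R • z) ∂μ =
      c * ∫ z in B, logPotential μ f (R • z) ∂μ + μ.real B * C :=
    calc ∫ z in B, u (R • z) ∂μ = ∫ z in B, ((u (R • z) - C) + C) ∂μ := by simp
      _ = ∫ z in B, (u (R • z) - C) ∂μ + μ.real B * C := by
          rw [integral_add hint (integrableOn_const hBfin), setIntegral_const, smul_eq_mul]
      _ = _ := by simp only [hC _, add_sub_cancel_right, integral_const_mul]
  rw [setAverage_eq, setAverage_eq, hsplit, smul_eq_mul, smul_eq_mul]
  field_simp

lemma mul_exp_setAverage_le (hu : Continuous u) (hw : ∀ x, 0 ≤ w x)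
    (hi : Integrable (fun x => w x * Real.exp (α * u x)) μ) {B : Set E} (hB : IsCompact B)
    (hB0 : μ B ≠ 0) {R m : ℝ} (hR : 0 < R) (hm : 0 ≤ m) (hwB : ∀ z ∈ B, m ≤ w (R • z)) :
    R ^ finrank ℝ E * (m * (μ.real B * Real.exp (α * ⨍ z in B, u (R • z) ∂μ))) ≤
      ∫ x, w x * Real.exp (α * u x) ∂μ := by
  have hBfin : μ B ≠ ⊤ := hB.measure_lt_top.ne
  have hB_pos : 0 < μ.real B := ENNReal.toReal_pos hB0 hBfin
  have huR : Continuous fun z => α * u (R • z) := by fun_prop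
  have hexp : IntegrableOn (fun z => Real.exp (α * u (R • z))) B μ :=
    (Real.continuous_exp.comp huR).continuousOn.integrableOn_compact hB
  have hiR : Integrable (fun z => w (R • z) * Real.exp (α * u (R • z))) μ := hi.comp_smul hR.ne'
  have jensen : Real.exp (⨍ z in B, α * u (R • z) ∂μ) ≤ ⨍ z in B, Real.exp (α * u (R • z)) ∂μ :=
    convexOn_exp.map_set_average_le Real.continuous_exp.continuousOn isClosed_univ hB0 hBfin
      (ae_of_all _ fun _ => Set.mem_univ _) (huR.continuousOn.integrableOn_compact hB) hexp
  have havg : ⨍ z in B, α * u (R • z) ∂μ = α * ⨍ z in B, u (R • z) ∂μ := by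
    simp only [setAverage_eq, integral_const_mul, smul_eq_mul, mul_left_comm]
  rw [havg, setAverage_eq μ fun z => Real.exp (α * u (R • z)), smul_eq_mul,
    ← div_eq_inv_mul, le_div_iff₀' hB_pos] at jensen
  rw [← integral_pow_mul_comp_smul (fun x => w x * Real.exp (α * u x)) hR, integral_const_mul]
  gcongr
  calc m * (μ.real B * Real.exp (α * ⨍ z in B, u (R • z) ∂μ))
      ≤ m * ∫ z in B, Real.exp (α * u (R • z)) ∂μ := by gcongr
    _ = ∫ z in B, m * Real.exp (α * u (R • z)) ∂μ := (integral_const_mul _ _).symm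
    _ ≤ ∫ z in B, w (R • z) * Real.exp (α * u (R • z)) ∂μ :=
        setIntegral_mono_on (hexp.const_mul m) hiR.integrableOn hB.measurableSet fun z hz =>
          mul_le_mul_of_nonneg_right (hwB z hz) (Real.exp_pos _).le
    _ ≤ ∫ z, w (R • z) * Real.exp (α * u (R • z)) ∂μ :=
        setIntegral_le_integral hiR (ae_of_all _ fun z => mul_nonneg (hw _) (Real.exp_pos _).le)

theorem IsLogSolution.finrank_add_le (hd : 2 ≤ finrank ℝ E) (hu : IsLogSolution μ c α Q u)
    (hw : ∀ x, 0 ≤ w x) (hi : Integrable (fun x => w x * Real.exp (α * u x)) μ) {k : ℕ}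
    (hk : HasConeGrowth w k) :
    (finrank ℝ E + k : ℝ) ≤ α * (c * ∫ y, Q y * Real.exp (α * u y) ∂μ) := by
  obtain ⟨q, ρ, hρ, κ, hκ, hgrowth⟩ := hk
  set B := closedBall q ρ
  have hB : IsCompact B := isCompact_closedBall q ρ
  have hB0 : μ B ≠ 0 := (measure_closedBall_pos _ q hρ).ne'
  have hB_pos : 0 < μ.real B := ENNReal.toReal_pos hB0 hB.measure_lt_top.ne
  have hlog : ∀ᶠ R : ℝ in atTop,
      Real.log (κ * μ.real B) / Real.log R + (finrank ℝ E + k) +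
        α * ((⨍ z in B, u (R • z) ∂μ) / Real.log R) ≤
      Real.log (∫ x, w x * Real.exp (α * u x) ∂μ) / Real.log R := by
    filter_upwards [hgrowth, eventually_gt_atTop 1] with R hwB hR
    have hR0 : 0 < R := by positivity
    have hlogR : 0 < Real.log R := Real.log_pos hR
    have hle := Real.log_le_log (by positivity) (mul_exp_setAverage_le hu.contDiff.continuous hw hi
      hB hB0 hR0 (by positivity) hwB)
    rw [show ∀ e : ℝ, R ^ finrank ℝ E * (κ * R ^ k * (μ.real B * e)) =
      κ * μ.real B * R ^ (finrank ℝ E + k) * e from fun e => by ring,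
      Real.log_mul (by positivity) (Real.exp_ne_zero _), Real.log_exp,
      Real.log_mul (by positivity) (by positivity), Real.log_pow] at hle
    rw [le_div_iff₀ hlogR]
    convert! hle using 1
    push_cast
    field_simp
  have hleft := ((Real.tendsto_log_atTop.const_div_atTop (Real.log (κ * μ.real B))).add_const
    (finrank ℝ E + k : ℝ)).add ((hu.tendsto_setAverage_div_log hd hB hB0).const_mul α)
  have := le_of_tendsto_of_tendsto hleft (Real.tendsto_log_atTop.const_div_atTop _) hlog
  linarith

end Decay

/-! ### The Pohozaev identity -/

section Divergence

variable {E : Type*} [NormedAddCommGroup E] [NormedSpace ℝ E]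

/-- The divergence of a vector field, as the trace of its derivative. -/
noncomputable def divergence (W : E → E) (x : E) : ℝ :=
  LinearMap.trace ℝ E (fderiv ℝ W x)

lemma hasCompactSupport_divergence {W : E → E} (hW : HasCompactSupport W) :
    HasCompactSupport (divergence W) :=
  (hW.fderiv ℝ).comp_left (g := fun A : E →L[ℝ] E => LinearMap.trace ℝ E A) (by simp)

variable [FiniteDimensional ℝ E]

lemma continuous_trace : Continuous fun A : E →L[ℝ] E => LinearMap.trace ℝ E A :=
  (LinearMap.trace ℝ E ∘ₗ ContinuousLinearMap.coeLM ℝ).continuous_of_finiteDimensional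

lemma continuous_divergence {W : E → E} (hW : ContDiff ℝ 1 W) : Continuous (divergence W) :=
  continuous_trace.comp (hW.continuous_fderiv one_ne_zero)

lemma divergence_smul {g : E → ℝ} {X : E → E} {x : E} (hg : DifferentiableAt ℝ g x)
    (hX : DifferentiableAt ℝ X x) :
    divergence (fun z => g z • X z) x = g x * divergence X x + fderiv ℝ g x (X x) := by
  simp only [divergence, fderiv_fun_smul hg hX, ContinuousLinearMap.toLinearMap_add,
    ContinuousLinearMap.toLinearMap_smul, map_add, map_smul, smul_eq_mul]
  exact congrArg _ (LinearMap.trace_smulRight (fderiv ℝ g x : E →ₗ[ℝ] ℝ) (X x))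

variable [MeasurableSpace E] [BorelSpace E] {μ : Measure E} [μ.IsAddHaarMeasure]

lemma integral_divergence {W : E → E} (hW : ContDiff ℝ 1 W) (hs : HasCompactSupport W) :
    ∫ x, divergence W x ∂μ = 0 := by
  have hint : Integrable (fderiv ℝ W) μ :=
    (hW.continuous_fderiv one_ne_zero).integrable_of_hasCompactSupport (hs.fderiv ℝ)
  have hzero : ∫ x, fderiv ℝ W x ∂μ = 0 := by
    ext v
    have hv := integral_smul_fderiv_eq_neg_fderiv_smul_of_integrable (μ := μ) (𝕜 := ℝ)
      (f := fun _ => (1 : ℝ)) (g := W) (v := v) (by simp)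
      (by simpa using hint.apply_continuousLinearMap v)
      (by simpa using hW.continuous.integrable_of_hasCompactSupport hs)
      (by simp) fun x _ => hW.differentiable one_ne_zero x
    rw [ContinuousLinearMap.integral_apply hint]
    simpa using hv
  calc ∫ x, divergence W x ∂μ = LinearMap.trace ℝ E (∫ x, fderiv ℝ W x ∂μ : E →L[ℝ] E) :=
        ContinuousLinearMap.integral_comp_comm (L := (⟨LinearMap.trace ℝ E ∘ₗ
          ContinuousLinearMap.coeLM ℝ, continuous_trace⟩ : (E →L[ℝ] E) →L[ℝ] ℝ)) hint
    _ = 0 := by simp [hzero]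

lemma integral_mul_divergence {g : E → ℝ} {W : E → E} (hg : ContDiff ℝ 1 g)
    (hW : ContDiff ℝ 1 W) (hs : HasCompactSupport W) :
    ∫ x, g x * divergence W x ∂μ = -∫ x, fderiv ℝ g x (W x) ∂μ := by
  have hzero : ∫ x, divergence (fun z => g z • W z) x ∂μ = 0 :=
    integral_divergence (hg.smul hW) hs.smul_left
  simp only [divergence_smul (hg.differentiable one_ne_zero _) (hW.differentiable one_ne_zero _)]
    at hzero
  rwa [integral_add, ← eq_neg_iff_add_eq_zero] at hzero
  · exact (hg.continuous.mul (continuous_divergence hW)).integrable_of_hasCompactSupport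
      (hasCompactSupport_divergence hs).mul_left
  · refine ((hg.continuous_fderiv one_ne_zero).clm_apply
      hW.continuous).integrable_of_hasCompactSupport (hs.mono fun x hx hWx => hx ?_)
    simp [hWx]

lemma integral_exp_mul_divergence {α : ℝ} {Q u : E → ℝ} {X : E → E} (hQ : ContDiff ℝ 1 Q)
    (hu : ContDiff ℝ 1 u) (hX : ContDiff ℝ 1 X) (hs : HasCompactSupport X) :
    ∫ x, Real.exp (α * u x) * (Q x * divergence X x + fderiv ℝ Q x (X x)) ∂μ =
      α * ∫ x, u x * divergence (fun z => (Q z * Real.exp (α * u z)) • X z) x ∂μ := by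
  have hexp : ContDiff ℝ 1 fun x => Real.exp (α * u x) := (contDiff_const.mul hu).exp
  have hfderiv : ∀ x, fderiv ℝ (fun x => Real.exp (α * u x)) x =
      Real.exp (α * u x) • α • fderiv ℝ u x := fun x =>
    ((hu.differentiable one_ne_zero x).hasFDerivAt.const_mul α).exp.fderiv
  calc ∫ x, Real.exp (α * u x) * (Q x * divergence X x + fderiv ℝ Q x (X x)) ∂μ
      = ∫ x, Real.exp (α * u x) * divergence (fun z => Q z • X z) x ∂μ := by
        simp only [divergence_smul (hQ.differentiable one_ne_zero _)
          (hX.differentiable one_ne_zero _)]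
    _ = -∫ x, fderiv ℝ (fun x => Real.exp (α * u x)) x (Q x • X x) ∂μ :=
        integral_mul_divergence hexp (hQ.smul hX) hs.smul_left
    _ = α * -∫ x, fderiv ℝ u x ((Q x * Real.exp (α * u x)) • X x) ∂μ := by
        rw [← integral_neg, ← integral_neg, ← integral_const_mul]
        congr! 2
        simp only [hfderiv, map_smul, _root_.smul_apply, smul_eq_mul]
        ring
    _ = α * ∫ x, u x * divergence (fun z => (Q z * Real.exp (α * u z)) • X z) x ∂μ :=
        congrArg (α * ·) (integral_mul_divergence hu ((hQ.mul hexp).smul hX) hs.smul_left).symm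

end Divergence

section LogGradient

variable {E : Type*} [NormedAddCommGroup E]

/-- A smooth regularisation of `log |x - y|`, recovered as `ε → 0`. -/
noncomputable def regLog (y : E) (ε : ℝ) (x : E) : ℝ := Real.log (‖x - y‖ ^ 2 + ε ^ 2) / 2

lemma abs_regLog_le {y x : E} {ε : ℝ} (hε : 0 ≤ ε) (hx : x ≠ y) :
    |regLog y ε x| ≤ ‖x - y‖ + ε + ‖x - y‖⁻¹ := by
  have hr : 0 < ‖x - y‖ := norm_sub_pos_iff.2 hx
  have hlower : ‖x - y‖ ≤ √(‖x - y‖ ^ 2 + ε ^ 2) := Real.le_sqrt_of_sq_le (by nlinarith)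
  have hupper : √(‖x - y‖ ^ 2 + ε ^ 2) ≤ ‖x - y‖ + ε :=
    Real.sqrt_le_iff.2 ⟨by positivity, by nlinarith [mul_nonneg hr.le hε]⟩
  rw [regLog, ← Real.log_sqrt (by positivity)]
  exact (abs_log_le (Real.sqrt_nonneg _)).trans (add_le_add hupper (inv_anti₀ hr hlower))

variable [InnerProductSpace ℝ E]

/-- The gradient `z / |z|²` of `log |z|`, with value `0` at the origin. -/
noncomputable def logGradient (z : E) : E := (‖z‖ ^ 2)⁻¹ • z

lemma norm_logGradient (z : E) : ‖logGradient z‖ = ‖z‖⁻¹ := by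
  rcases eq_or_ne z 0 with rfl | hz
  · simp [logGradient]
  have := norm_ne_zero_iff.2 hz
  rw [logGradient, norm_smul, norm_inv, norm_pow, norm_norm]
  field_simp

lemma logGradient_neg (z : E) : logGradient (-z) = -logGradient z := by
  simp only [logGradient, norm_neg, smul_neg]

lemma measurable_logGradient [MeasurableSpace E] [BorelSpace E] [SecondCountableTopology E] :
    Measurable (logGradient : E → E) :=
  (measurable_norm.pow_const 2).inv.smul measurable_id

lemma hasFDerivAt_regLog (y x : E) {ε : ℝ} (hε : 0 < ε) :
    HasFDerivAt (regLog y ε) ((‖x - y‖ ^ 2 + ε ^ 2)⁻¹ • innerSL ℝ (x - y)) x := by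
  have hpos : ‖x - y‖ ^ 2 + ε ^ 2 ≠ 0 := by positivity
  convert! ((((hasFDerivAt_id x).sub_const y).norm_sq.add_const (ε ^ 2)).log hpos).mul_const
    (2⁻¹ : ℝ) using 1
  ext v
  simp
  ring

lemma contDiff_regLog (y : E) {ε : ℝ} (hε : 0 < ε) : ContDiff ℝ 1 (regLog y ε) :=
  ((((contDiff_id.sub contDiff_const).norm_sq ℝ).add contDiff_const).log
    fun x => by positivity).div_const 2

variable [MeasurableSpace E] [BorelSpace E] [FiniteDimensional ℝ E]
  {μ : Measure E} [μ.IsAddHaarMeasure]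

lemma tendsto_integral_regLog_mul (hd : 2 ≤ finrank ℝ E) {D : E → ℝ} (hD : Continuous D)
    (hs : HasCompactSupport D) (y : E) :
    Tendsto (fun ε => ∫ x, regLog y ε x * D x ∂μ) (𝓝[>] 0)
      (𝓝 (∫ x, Real.log ‖x - y‖ * D x ∂μ)) := by
  have hne := ae_ne (μ := μ) (zero_lt_two.trans_le hd) y
  have hDi := hD.integrable_of_hasCompactSupport (μ := μ) hs
  have hbound : Integrable (fun x => |D x| * (‖x - y‖ + 1) + |D x| * ‖x - y‖⁻¹) μ :=
    (Continuous.integrable_of_hasCompactSupport (by fun_prop) hs.norm.mul_right).add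
      (integrable_mul_norm_sub_inv hd hDi.abs hD.abs y)
  refine tendsto_integral_filter_of_dominated_convergence _ ?_ ?_ hbound ?_
  · filter_upwards [self_mem_nhdsWithin] with ε hε
    exact ((contDiff_regLog y hε).continuous.mul hD).aestronglyMeasurable
  · filter_upwards [Ioo_mem_nhdsGT one_pos] with ε hε
    filter_upwards [hne] with x hx
    calc ‖regLog y ε x * D x‖ = |D x| * |regLog y ε x| := by
          rw [norm_mul, mul_comm, Real.norm_eq_abs, Real.norm_eq_abs]
      _ ≤ |D x| * (‖x - y‖ + 1 + ‖x - y‖⁻¹) := by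
          gcongr
          linarith [abs_regLog_le hε.1.le hx, hε.2]
      _ = _ := mul_add _ _ _
  · filter_upwards [hne] with x hx
    have hr : ‖x - y‖ ^ 2 ≠ 0 := (pow_pos (norm_sub_pos_iff.2 hx) 2).ne'
    have hcont : ContinuousAt (fun ε => regLog y ε x) 0 :=
      ((continuousAt_const.add (continuousAt_id.pow 2)).log (by simpa using hr)).div_const 2
    have := (hcont.tendsto.mono_left (nhdsWithin_le_nhds (s := Set.Ioi 0))).mul_const (D x)
    simpa [regLog, Real.log_pow] using this

lemma tendsto_integral_fderiv_regLog (hd : 2 ≤ finrank ℝ E) {W : E → E} (hW : Continuous W)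
    (hs : HasCompactSupport W) (y : E) :
    Tendsto (fun ε => ∫ x, fderiv ℝ (regLog y ε) x (W x) ∂μ) (𝓝[>] 0)
      (𝓝 (∫ x, inner ℝ (logGradient (x - y)) (W x) ∂μ)) := by
  have hne := ae_ne (μ := μ) (zero_lt_two.trans_le hd) y
  refine tendsto_integral_filter_of_dominated_convergence (fun x => ‖W x‖ * ‖x - y‖⁻¹) ?_ ?_
    (integrable_mul_norm_sub_inv hd (hW.integrable_of_hasCompactSupport hs).norm hW.norm y) ?_
  · filter_upwards [self_mem_nhdsWithin] with ε hε
    exact (((contDiff_regLog y hε).continuous_fderiv one_ne_zero).clm_apply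
      hW).aestronglyMeasurable
  · filter_upwards [self_mem_nhdsWithin] with ε hε
    filter_upwards [hne] with x hx
    have hr : 0 < ‖x - y‖ := norm_sub_pos_iff.2 hx
    rw [(hasFDerivAt_regLog y x hε).fderiv]
    calc ‖(‖x - y‖ ^ 2 + ε ^ 2)⁻¹ * inner ℝ (x - y) (W x)‖
        ≤ (‖x - y‖ ^ 2)⁻¹ * (‖x - y‖ * ‖W x‖) := by
          rw [norm_mul, norm_inv, Real.norm_of_nonneg (by positivity)]
          gcongr
          · exact le_add_of_nonneg_right (sq_nonneg ε)
          · exact norm_inner_le_norm _ _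
      _ = ‖W x‖ * ‖x - y‖⁻¹ := by field_simp
  · filter_upwards [hne] with x hx
    have hr : ‖x - y‖ ^ 2 ≠ 0 := (pow_pos (norm_sub_pos_iff.2 hx) 2).ne'
    have hcont : ContinuousAt (fun ε : ℝ => (‖x - y‖ ^ 2 + ε ^ 2)⁻¹ * inner ℝ (x - y) (W x)) 0 :=
      ((continuousAt_const.add (continuousAt_id.pow 2)).inv₀ (by simpa using hr)).mul_const _
    have hlim := hcont.tendsto.mono_left (nhdsWithin_le_nhds (s := Set.Ioi 0))
    rw [logGradient, real_inner_smul_left]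
    refine (by simpa using hlim : Tendsto _ _ _).congr' ?_
    filter_upwards [self_mem_nhdsWithin] with ε hε
    rw [(hasFDerivAt_regLog y x hε).fderiv]
    rfl

lemma integral_log_norm_sub_mul_divergence (hd : 2 ≤ finrank ℝ E) {W : E → E}
    (hW : ContDiff ℝ 1 W) (hs : HasCompactSupport W) (y : E) :
    ∫ x, Real.log ‖x - y‖ * divergence W x ∂μ =
      -∫ x, inner ℝ (logGradient (x - y)) (W x) ∂μ := by
  refine tendsto_nhds_unique (tendsto_integral_regLog_mul hd (continuous_divergence hW)
    (hasCompactSupport_divergence hs) y) ?_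
  refine (tendsto_integral_fderiv_regLog hd hW.continuous hs y).neg.congr' ?_
  filter_upwards [self_mem_nhdsWithin] with ε hε
  exact (integral_mul_divergence (contDiff_regLog y hε) hW hs).symm

lemma integral_logKernel_mul_divergence (hd : 2 ≤ finrank ℝ E) {W : E → E}
    (hW : ContDiff ℝ 1 W) (hs : HasCompactSupport W) {y : E} (hy : y ≠ 0) :
    ∫ x, logKernel x y * divergence W x ∂μ = ∫ x, inner ℝ (logGradient (x - y)) (W x) ∂μ := by
  have hDc := continuous_divergence hW
  have hDs := hasCompactSupport_divergence hs
  calc ∫ x, logKernel x y * divergence W x ∂μ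
      = ∫ x, (Real.log ‖y‖ * divergence W x - Real.log ‖x - y‖ * divergence W x) ∂μ := by
        refine integral_congr_ae ?_
        filter_upwards [ae_ne (zero_lt_two.trans_le hd) y] with x hx
        rw [logKernel, Real.log_div (norm_ne_zero_iff.2 hy) (norm_sub_pos_iff.2 hx).ne', sub_mul]
    _ = ∫ x, inner ℝ (logGradient (x - y)) (W x) ∂μ := by
        rw [integral_sub ((hDc.integrable_of_hasCompactSupport hDs).const_mul _)
          (integrable_log_norm_sub_mul hd hDc hDs y), integral_const_mul,
          integral_divergence hW hs, integral_log_norm_sub_mul_divergence hd hW hs]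
        ring

lemma integral_logPotential_mul_divergence (hd : 2 ≤ finrank ℝ E) {f : E → ℝ}
    (hf : Integrable f μ) (hfc : Continuous f) {W : E → E} (hW : ContDiff ℝ 1 W)
    (hs : HasCompactSupport W) :
    ∫ x, logPotential μ f x * divergence W x ∂μ =
      ∫ y, f y * ∫ x, inner ℝ (logGradient (x - y)) (W x) ∂μ ∂μ := by
  have hDc := continuous_divergence hW
  have hgc : Continuous fun x => ‖x‖ * divergence W x := continuous_norm.mul hDc
  have hgs : HasCompactSupport fun x => ‖x‖ * divergence W x :=
    (hasCompactSupport_divergence hs).mul_left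
  obtain ⟨M, hM⟩ := hgc.bounded_above_of_compact_support hgs
  rw [integral_logPotential_mul hd hf hfc hDc.aestronglyMeasurable
    (hgc.integrable_of_hasCompactSupport hgs) hM]
  refine integral_congr_ae ?_
  filter_upwards [ae_ne (zero_lt_two.trans_le hd) 0] with y hy
  rw [integral_logKernel_mul_divergence hd hW hs hy]

end LogGradient

section Symmetrisation

variable {E : Type*} [NormedAddCommGroup E] [InnerProductSpace ℝ E]

/-- The kernel `⟪X x - X y, ∇ log |x - y|⟫`, which is bounded for Lipschitz `X`. It arises by
symmetrising the singular kernel `⟪X x, ∇ log |x - y|⟫` in `x` and `y`. -/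
noncomputable def symmKernel (X : E → E) (q : E × E) : ℝ :=
  inner ℝ (logGradient (q.1 - q.2)) (X q.1 - X q.2)

lemma abs_symmKernel_le {X : E → E} {L : NNReal} (hX : LipschitzWith L X) (q : E × E) :
    |symmKernel X q| ≤ L :=
  calc |symmKernel X q| ≤ ‖logGradient (q.1 - q.2)‖ * ‖X q.1 - X q.2‖ :=
        abs_real_inner_le_norm _ _
    _ ≤ ‖q.1 - q.2‖⁻¹ * (L * ‖q.1 - q.2‖) := by
        rw [norm_logGradient]
        gcongr
        exact hX.norm_sub_le q.1 q.2
    _ = L * (‖q.1 - q.2‖⁻¹ * ‖q.1 - q.2‖) := by ring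
    _ ≤ L := mul_le_of_le_one_right L.coe_nonneg inv_mul_le_one

variable [MeasurableSpace E] [BorelSpace E] [FiniteDimensional ℝ E]

lemma measurable_symmKernel {X : E → E} (hX : Continuous X) : Measurable (symmKernel X) :=
  (measurable_logGradient.comp (measurable_fst.sub measurable_snd)).inner
    ((hX.measurable.comp measurable_fst).sub (hX.measurable.comp measurable_snd))

variable {μ : Measure E} [μ.IsAddHaarMeasure] {f : E → ℝ} {X : E → E}

lemma integrable_prod_inner_logGradient (hd : 2 ≤ finrank ℝ E) (hf : Integrable f μ)
    (hfc : Continuous f) (hX : Continuous X) (hs : HasCompactSupport X) :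
    Integrable (fun q : E × E => f q.1 * f q.2 * inner ℝ (logGradient (q.1 - q.2)) (X q.1))
      (μ.prod μ) := by
  have hg : Continuous fun x => f x * ‖X x‖ := hfc.mul hX.norm
  have hgs : HasCompactSupport fun x => f x * ‖X x‖ := hs.norm.mul_left
  obtain ⟨M, hM⟩ := hg.bounded_above_of_compact_support hgs
  refine (integrable_prod_mul_norm_sub_inv hd hf (hg.integrable_of_hasCompactSupport hgs)
    hM).norm.mono' (Measurable.aestronglyMeasurable ?_) (ae_of_all _ fun q => ?_)
  · exact ((hfc.measurable.comp measurable_fst).mul (hfc.measurable.comp measurable_snd)).mul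
      ((measurable_logGradient.comp (measurable_fst.sub measurable_snd)).inner
        (hX.measurable.comp measurable_fst))
  · simp only [norm_mul, norm_norm, norm_inv]
    calc ‖f q.1‖ * ‖f q.2‖ * ‖inner ℝ (logGradient (q.1 - q.2)) (X q.1)‖
        ≤ ‖f q.1‖ * ‖f q.2‖ * (‖logGradient (q.1 - q.2)‖ * ‖X q.1‖) := by
          gcongr
          exact norm_inner_le_norm _ _
      _ = ‖f q.1‖ * ‖X q.1‖ * ‖f q.2‖ * ‖q.1 - q.2‖⁻¹ := by rw [norm_logGradient]; ring

lemma two_mul_integral_inner_logGradient (hd : 2 ≤ finrank ℝ E) (hf : Integrable f μ)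
    (hfc : Continuous f) (hX : Continuous X) (hs : HasCompactSupport X) :
    2 * ∫ y, f y * ∫ x, inner ℝ (logGradient (x - y)) (f x • X x) ∂μ ∂μ =
      ∫ q, f q.1 * f q.2 * symmKernel X q ∂μ.prod μ := by
  set H : E × E → ℝ := fun q => f q.1 * f q.2 * inner ℝ (logGradient (q.1 - q.2)) (X q.1)
  have hH : Integrable H (μ.prod μ) := integrable_prod_inner_logGradient hd hf hfc hX hs
  have hiter : ∫ y, f y * ∫ x, inner ℝ (logGradient (x - y)) (f x • X x) ∂μ ∂μ =
      ∫ q, H q ∂μ.prod μ := by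
    rw [integral_prod_symm _ hH]
    congr! 2 with y
    rw [← integral_const_mul]
    congr! 2
    rw [real_inner_smul_right]
    ring
  calc 2 * ∫ y, f y * ∫ x, inner ℝ (logGradient (x - y)) (f x • X x) ∂μ ∂μ
      = ∫ q, H q ∂μ.prod μ + ∫ q, H q.swap ∂μ.prod μ := by rw [integral_prod_swap, hiter, two_mul]
    _ = ∫ q, (H q + H q.swap) ∂μ.prod μ := (integral_add hH hH.swap).symm
    _ = ∫ q, f q.1 * f q.2 * symmKernel X q ∂μ.prod μ := by
        refine integral_congr_ae (ae_of_all _ fun q => ?_)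
        simp only [H, symmKernel, Prod.fst_swap, Prod.snd_swap, inner_sub_right]
        rw [← neg_sub q.1 q.2, logGradient_neg, inner_neg_left]
        ring

end Symmetrisation

section Pohozaev

variable {E : Type*} [NormedAddCommGroup E] [InnerProductSpace ℝ E] [MeasurableSpace E]
  [BorelSpace E] [FiniteDimensional ℝ E] {μ : Measure E} [μ.IsAddHaarMeasure]
  {c α : ℝ} {Q u : E → ℝ} {X : E → E}

lemma IsLogSolution.integral_mul_divergence (hd : 2 ≤ finrank ℝ E)
    (hu : IsLogSolution μ c α Q u) {W : E → E} (hW : ContDiff ℝ 1 W) (hs : HasCompactSupport W) :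
    ∫ x, u x * divergence W x ∂μ = c * ∫ y, (Q y * Real.exp (α * u y)) *
      ∫ x, inner ℝ (logGradient (x - y)) (W x) ∂μ ∂μ := by
  obtain ⟨C, hC⟩ := hu.exists_const
  have hDc := continuous_divergence hW
  have hDs := hasCompactSupport_divergence hs
  have hint : Integrable (fun x => (u x - C) * divergence W x) μ :=
    ((hu.contDiff.continuous.sub continuous_const).mul hDc).integrable_of_hasCompactSupport
      hDs.mul_left
  calc ∫ x, u x * divergence W x ∂μ
      = ∫ x, ((u x - C) * divergence W x + C * divergence W x) ∂μ := by
        simp only [← add_mul, sub_add_cancel]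
    _ = ∫ x, (u x - C) * divergence W x ∂μ := by
        rw [integral_add hint ((hDc.integrable_of_hasCompactSupport hDs).const_mul C),
          integral_const_mul, integral_divergence hW hs, mul_zero, add_zero]
    _ = c * ∫ x, logPotential μ (fun y => Q y * Real.exp (α * u y)) x * divergence W x ∂μ := by
        rw [← integral_const_mul]
        congr! 2
        rw [hC]
        ring
    _ = _ := by
        rw [integral_logPotential_mul_divergence hd hu.integrable hu.contDiff_density.continuous
          hW hs]

theorem IsLogSolution.pohozaev_of_hasCompactSupport (hd : 2 ≤ finrank ℝ E)
    (hu : IsLogSolution μ c α Q u) (hX : ContDiff ℝ 1 X) (hs : HasCompactSupport X) :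
    ∫ x, Real.exp (α * u x) * (Q x * divergence X x + fderiv ℝ Q x (X x)) ∂μ =
      α * c / 2 * ∫ q, (Q q.1 * Real.exp (α * u q.1)) * (Q q.2 * Real.exp (α * u q.2)) *
        symmKernel X q ∂μ.prod μ := by
  have hW : ContDiff ℝ 1 fun x => (Q x * Real.exp (α * u x)) • X x := hu.contDiff_density.smul hX
  rw [integral_exp_mul_divergence hu.contDiff_curvature hu.contDiff hX hs,
    hu.integral_mul_divergence hd hW hs.smul_left,
    ← two_mul_integral_inner_logGradient hd hu.integrable hu.contDiff_density.continuous
      hX.continuous hs]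
  ring

end Pohozaev

section TruncatedDilation

variable {E : Type*} [NormedAddCommGroup E] [InnerProductSpace ℝ E] [FiniteDimensional ℝ E]

/-- A smooth cutoff, equal to `1` on the ball of radius `k + 1` around `p` and supported in the ball
of twice that radius. -/
noncomputable def cutoff (p : E) (k : ℕ) : ContDiffBump p :=
  ⟨k + 1, 2 * (k + 1), by positivity, by linarith [(k.cast_nonneg : (0 : ℝ) ≤ k)]⟩

/-- The generator `x ↦ x - p` of the dilations about `p`, cut off at scale `k + 1`. -/
noncomputable def dilationField (p : E) (k : ℕ) (x : E) : E := cutoff p k x • (x - p)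

lemma eventually_cutoff_eq_one (p x : E) : ∀ᶠ k : ℕ in atTop, cutoff p k x = 1 := by
  filter_upwards [eventually_ge_atTop ⌈dist x p⌉₊] with k hk
  refine (cutoff p k).one_of_mem_closedBall (mem_closedBall.2 ?_)
  exact (Nat.ceil_le.1 hk).trans (le_add_of_nonneg_right zero_le_one)

lemma contDiff_dilationField (p : E) (k : ℕ) : ContDiff ℝ 1 (dilationField p k) :=
  (cutoff p k).contDiff.smul (contDiff_id.sub contDiff_const)

lemma hasCompactSupport_dilationField (p : E) (k : ℕ) : HasCompactSupport (dilationField p k) :=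
  (cutoff p k).hasCompactSupport.smul_right

lemma dilationField_eq_smul (p : E) (k : ℕ) (x : E) :
    dilationField p k x = (k + 1 : ℝ) • dilationField 0 0 ((k + 1 : ℝ)⁻¹ • (x - p)) := by
  have hk : (k + 1 : ℝ) ≠ 0 := k.cast_add_one_ne_zero
  have hcutoff : cutoff p k x = cutoff (0 : E) 0 ((k + 1 : ℝ)⁻¹ • (x - p)) := by
    simp only [ContDiffBump.apply, cutoff, Nat.cast_zero, zero_add, inv_one, one_smul, sub_zero,
      mul_div_cancel_right₀ _ hk, mul_one, div_one]
  simp only [dilationField, hcutoff, sub_zero, smul_comm _ (cutoff (0 : E) 0 _), smul_inv_smul₀ hk]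

lemma exists_lipschitzWith_dilationField (p : E) :
    ∃ L : NNReal, ∀ k, LipschitzWith L (dilationField p k) := by
  obtain ⟨L, hL⟩ := (contDiff_dilationField (0 : E) 0).lipschitzWith_of_hasCompactSupport
    (hasCompactSupport_dilationField 0 0) one_ne_zero
  refine ⟨L, fun k => LipschitzWith.of_dist_le_mul fun x y => ?_⟩
  have hk : (0 : ℝ) < k + 1 := by positivity
  rw [dilationField_eq_smul, dilationField_eq_smul p k y, dist_smul₀, Real.norm_of_nonneg hk.le]
  calc (k + 1 : ℝ) * dist (dilationField 0 0 ((k + 1 : ℝ)⁻¹ • (x - p)))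
        (dilationField 0 0 ((k + 1 : ℝ)⁻¹ • (y - p)))
      ≤ (k + 1) * (L * dist ((k + 1 : ℝ)⁻¹ • (x - p)) ((k + 1 : ℝ)⁻¹ • (y - p))) := by
        gcongr
        exact hL.dist_le_mul _ _
    _ = L * dist x y := by
        rw [dist_smul₀, dist_sub_right, norm_inv, Real.norm_of_nonneg hk.le]
        field_simp

lemma abs_divergence_le {X : E → E} {L : NNReal} (hX : LipschitzWith L X) (x : E) :
    |divergence X x| ≤ finrank ℝ E * L := by
  let b := stdOrthonormalBasis ℝ E
  calc |divergence X x| = |∑ i, inner ℝ (b i) (fderiv ℝ X x (b i))| := by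
        rw [divergence, LinearMap.trace_eq_sum_inner _ b]
        rfl
    _ ≤ ∑ i, |inner ℝ (b i) (fderiv ℝ X x (b i))| := Finset.abs_sum_le_sum_abs _ _
    _ ≤ ∑ _i : Fin (finrank ℝ E), (L : ℝ) := by
        refine Finset.sum_le_sum fun i _ => (abs_real_inner_le_norm _ _).trans ?_
        rw [b.norm_eq_one, one_mul]
        exact ((fderiv ℝ X x).unit_le_opNorm _ (b.norm_eq_one i).le).trans
          (norm_fderiv_le_of_lipschitz ℝ hX)
    _ = finrank ℝ E * L := by simp

lemma eventually_divergence_dilationField_eq (p x : E) :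
    ∀ᶠ k : ℕ in atTop, divergence (dilationField p k) x = finrank ℝ E := by
  filter_upwards [eventually_ge_atTop ⌈dist x p⌉₊] with k hk
  have hx : x ∈ ball p (cutoff p k).rIn :=
    mem_ball.2 ((Nat.ceil_le.1 hk).trans_lt (lt_add_one _))
  have hloc : dilationField p k =ᶠ[𝓝 x] fun z => z - p := by
    filter_upwards [(cutoff p k).eventuallyEq_one_of_mem_ball hx] with z hz
    rw [dilationField, hz, Pi.one_apply, one_smul]
  simp [divergence, hloc.fderiv_eq, fderiv_sub_const]

lemma eventually_symmKernel_dilationField_eq_one (p : E) {q : E × E} (hq : q.1 ≠ q.2) :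
    ∀ᶠ k : ℕ in atTop, symmKernel (dilationField p k) q = 1 := by
  have hr : ‖q.1 - q.2‖ ≠ 0 := (norm_sub_pos_iff.2 hq).ne'
  filter_upwards [eventually_cutoff_eq_one p q.1, eventually_cutoff_eq_one p q.2] with k h₁ h₂
  rw [symmKernel, dilationField, dilationField, h₁, h₂, one_smul, one_smul,
    sub_sub_sub_cancel_right, logGradient, real_inner_smul_left, real_inner_self_eq_norm_sq,
    inv_mul_cancel₀ (pow_ne_zero 2 hr)]

end TruncatedDilation

lemma tendsto_integral_mul_of_eventually_eq {X : Type*} [MeasurableSpace X] {ν : Measure X}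
    {f : X → ℝ} (hf : Integrable f ν) {h : ℕ → X → ℝ}
    (hh : ∀ k, AEStronglyMeasurable (h k) ν) {M : ℝ} (hM : ∀ k x, |h k x| ≤ M) {a : ℝ}
    (ha : ∀ᵐ x ∂ν, ∀ᶠ k in atTop, h k x = a) :
    Tendsto (fun k => ∫ x, f x * h k x ∂ν) atTop (𝓝 ((∫ x, f x ∂ν) * a)) := by
  rw [← integral_mul_const]
  refine tendsto_integral_of_dominated_convergence (fun x => ‖f x‖ * M)
    (fun k => hf.aestronglyMeasurable.mul (hh k)) (hf.norm.mul_const M)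
    (fun k => ae_of_all _ fun x => ?_) ?_
  · rw [norm_mul]
    exact mul_le_mul_of_nonneg_left (hM k x) (norm_nonneg _)
  · filter_upwards [ha] with x hx
    exact tendsto_nhds_of_eventually_eq (hx.mono fun k hk => by rw [hk])

section PohozaevLimit

variable {E : Type*} [NormedAddCommGroup E] [InnerProductSpace ℝ E] [MeasurableSpace E]
  [BorelSpace E] {μ : Measure E} [μ.IsAddHaarMeasure] {c α : ℝ} {Q u : E → ℝ}

lemma IsLogSolution.integrable_exp_mul_fderiv (hu : IsLogSolution μ c α Q u) {X : E → E}
    (hX : ContDiff ℝ 1 X) (hs : HasCompactSupport X) :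
    Integrable (fun x => Real.exp (α * u x) * fderiv ℝ Q x (X x)) μ :=
  (hu.contDiff_exp.continuous.mul ((hu.contDiff_curvature.continuous_fderiv
    one_ne_zero).clm_apply hX.continuous)).integrable_of_hasCompactSupport
    (hs.mono fun x hx hXx => hx (by simp [hXx]))

variable [FiniteDimensional ℝ E]

theorem IsLogSolution.tendsto_pohozaev (hd : 2 ≤ finrank ℝ E) (hu : IsLogSolution μ c α Q u)
    (p : E) :
    Tendsto (fun k => ∫ x, Real.exp (α * u x) * fderiv ℝ Q x (dilationField p k x) ∂μ) atTop
      (𝓝 (α * c / 2 * (∫ x, Q x * Real.exp (α * u x) ∂μ) ^ 2 -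
        finrank ℝ E * ∫ x, Q x * Real.exp (α * u x) ∂μ)) := by
  set f := fun x => Q x * Real.exp (α * u x)
  have hX := fun k => contDiff_dilationField p k
  have hXs := fun k => hasCompactSupport_dilationField p k
  obtain ⟨L, hL⟩ := exists_lipschitzWith_dilationField p
  have hdiv : Tendsto (fun k => ∫ x, f x * divergence (dilationField p k) x ∂μ) atTop
      (𝓝 ((∫ x, f x ∂μ) * finrank ℝ E)) :=
    tendsto_integral_mul_of_eventually_eq hu.integrable
      (fun k => (continuous_divergence (hX k)).aestronglyMeasurable)
      (fun k => abs_divergence_le (hL k))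
      (ae_of_all _ fun x => eventually_divergence_dilationField_eq p x)
  have hker : Tendsto (fun k => ∫ q, f q.1 * f q.2 * symmKernel (dilationField p k) q ∂μ.prod μ)
      atTop (𝓝 ((∫ q : E × E, f q.1 * f q.2 ∂μ.prod μ) * 1)) :=
    tendsto_integral_mul_of_eventually_eq (hu.integrable.mul_prod hu.integrable)
      (fun k => (measurable_symmKernel (hX k).continuous).aestronglyMeasurable)
      (fun k => abs_symmKernel_le (hL k))
      ((ae_fst_ne_snd (zero_lt_two.trans_le hd)).mono fun q =>
        eventually_symmKernel_dilationField_eq_one p)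
  rw [mul_one, integral_prod_mul, ← sq] at hker
  rw [mul_comm (finrank ℝ E : ℝ)]
  refine ((hker.const_mul (α * c / 2)).sub hdiv).congr fun k => ?_
  rw [← hu.pohozaev_of_hasCompactSupport hd (hX k) (hXs k), sub_eq_iff_eq_add, ← integral_add]
  · congr! 2
    simp only [f]
    ring
  · exact hu.integrable_exp_mul_fderiv (hX k) (hXs k)
  · exact (hu.contDiff_density.continuous.mul
      (continuous_divergence (hX k))).integrable_of_hasCompactSupport
      (hasCompactSupport_divergence (hXs k)).mul_left

theorem IsLogSolution.pohozaev_le (hd : 2 ≤ finrank ℝ E) (hu : IsLogSolution μ c α Q u)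
    {ℓ : E → ℝ} {p : E} (hℓ : ∀ x, ℓ x ≤ fderiv ℝ Q x (x - p))
    (hi : Integrable (fun x => ℓ x * Real.exp (α * u x)) μ) :
    ∫ x, ℓ x * Real.exp (α * u x) ∂μ ≤ α * c / 2 * (∫ x, Q x * Real.exp (α * u x) ∂μ) ^ 2 -
      finrank ℝ E * ∫ x, Q x * Real.exp (α * u x) ∂μ := by
  have hcutoff : ∀ k x, |cutoff p k x| ≤ 1 := fun k x =>
    (abs_of_nonneg (cutoff p k).nonneg).trans_le (cutoff p k).le_one
  have hcont : ∀ k, AEStronglyMeasurable (cutoff p k) μ := fun k =>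
    (cutoff p k).continuous.aestronglyMeasurable
  have hlim := tendsto_integral_mul_of_eventually_eq hi hcont hcutoff
    (ae_of_all _ (eventually_cutoff_eq_one p))
  rw [mul_one] at hlim
  refine le_of_tendsto_of_tendsto' hlim (hu.tendsto_pohozaev hd p) fun k =>
    integral_mono (hi.mul_bdd (hcont k) (ae_of_all _ (hcutoff k)))
      (hu.integrable_exp_mul_fderiv (contDiff_dilationField p k)
        (hasCompactSupport_dilationField p k)) fun x => ?_
  have := mul_le_mul_of_nonneg_left (hℓ x)
    (mul_nonneg (Real.exp_pos (α * u x)).le ((cutoff p k).nonneg (x := x)))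
  simp only [dilationField, map_smul, smul_eq_mul]
  linarith

end PohozaevLimit

/-! ### Comparison of volumes -/

section VolumeComparison

lemma lt_of_pohozaev {N d A B P t : ℝ} (hd : 0 ≤ d) (hA : 0 < A) (hmass : t * A = B + P)
    (hdecay : N + d ≤ 2 * N * t) (hN : 0 < N) (ht : t < 1)
    (hpohozaev : d * P ≤ N * A * (t * (t - 1))) : A < B := by
  have hdt : 0 < N * t - d := by nlinarith
  refine lt_of_mul_lt_mul_left ?_ hd
  calc d * A < d * A + A * ((1 - t) * (N * t - d)) :=
        lt_add_of_pos_right _ (mul_pos hA (mul_pos (sub_pos.2 ht) hdt))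
    _ = d * (t * A) - N * A * (t * (t - 1)) := by ring
    _ ≤ d * (t * A) - d * P := by gcongr
    _ = d * B := by rw [hmass]; ring

lemma eq_zero_of_integral_mul_exp_eq_zero {X : Type*} [TopologicalSpace X] [MeasurableSpace X]
    {μ : Measure X} [μ.IsOpenPosMeasure] {f v : X → ℝ} (hf : Continuous f) (hv : Continuous v)
    (h0 : ∀ x, f x ≤ 0) (hi : Integrable (fun x => f x * Real.exp (v x)) μ)
    (h : ∫ x, f x * Real.exp (v x) ∂μ = 0) : f = 0 := by
  have hneg : 0 ≤ fun x => -(f x * Real.exp (v x)) := fun x =>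
    neg_nonneg.2 (mul_nonpos_of_nonpos_of_nonneg (h0 x) (Real.exp_pos _).le)
  have hae := (integral_eq_zero_iff_of_nonneg hneg hi.neg).1 (by rw [integral_neg, h, neg_zero])
  have heq := (Continuous.ae_eq_iff_eq μ (by fun_prop) continuous_const).1 hae
  exact funext fun x => (mul_eq_zero.1 (neg_eq_zero.1 (congrFun heq x))).resolve_right
    (Real.exp_ne_zero _)

/-- `f` satisfies Euler's inequality of degree `d` about `p`: its derivative along the dilations
about `p` is at least `d f`, as is the case (with equality) for `d`-homogeneous functions. -/
def EulerInequality {E : Type*} [NormedAddCommGroup E] [NormedSpace ℝ E] (d : ℝ) (f : E → ℝ)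
    (p : E) : Prop :=
  ∀ x, d * f x ≤ fderiv ℝ f x (x - p)

section ConstAdd

variable {E : Type*} [NormedAddCommGroup E] [NormedSpace ℝ E] [MeasurableSpace E] {μ : Measure E}
  {c α F : ℝ} {φ u : E → ℝ}

lemma IsLogSolution.continuous_of_const_add (hu : IsLogSolution μ c α (fun x => F + φ x) u) :
    Continuous φ :=
  (hu.contDiff_curvature.continuous.sub continuous_const).congr fun _ => add_sub_cancel_left F _

lemma IsLogSolution.integrable_mul_exp_of_const_add
    (hu : IsLogSolution μ c α (fun x => F + φ x) u)
    (hV : Integrable (fun x => Real.exp (α * u x)) μ) :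
    Integrable (fun x => φ x * Real.exp (α * u x)) μ :=
  (hu.integrable.sub (hV.const_mul F)).congr (ae_of_all _ fun x => by
    simp only [Pi.sub_apply]
    ring)

end ConstAdd

variable {E : Type*} [NormedAddCommGroup E] [InnerProductSpace ℝ E] [FiniteDimensional ℝ E]
  [MeasurableSpace E] [BorelSpace E] {μ : Measure E} [μ.IsAddHaarMeasure]
  {F S : ℝ} {φ u : E → ℝ}

lemma IsLogSolution.pohozaev_normalised_le (hd : 2 ≤ finrank ℝ E) (hF : 0 < F) (hS : 0 < S)
    (hu : IsLogSolution μ (2 / (F * S)) (finrank ℝ E) (fun x => F + φ x) u)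
    (hi : Integrable (fun x => φ x * Real.exp (finrank ℝ E * u x)) μ) {d t : ℝ}
    (hmass : t * (F * S) = ∫ x, (F + φ x) * Real.exp (finrank ℝ E * u x) ∂μ) {p : E}
    (hp : EulerInequality d φ p) :
    d * ∫ x, φ x * Real.exp (finrank ℝ E * u x) ∂μ ≤
      finrank ℝ E * (F * S) * (t * (t - 1)) := by
  have h := hu.pohozaev_le hd (ℓ := fun x => d * φ x) (p := p)
    (fun x => by rw [fderiv_const_add]; exact hp x)
    (by simpa only [mul_assoc] using hi.const_mul d)
  rw [← hmass] at h
  simp only [mul_assoc d, integral_const_mul] at h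
  refine h.trans_eq ?_
  field_simp

lemma IsLogSolution.integral_exp_eq (hd : 2 ≤ finrank ℝ E) (hF : 0 < F) (hS : 0 < S)
    (hu : IsLogSolution μ (2 / (F * S)) (finrank ℝ E) (fun _ => F) u) :
    ∫ x, Real.exp (finrank ℝ E * u x) ∂μ = S := by
  set V := ∫ x, Real.exp (finrank ℝ E * u x) ∂μ
  have hV : 0 < V := integral_exp_pos ((integrable_const_mul_iff hF.ne'.isUnit _).1 hu.integrable)
  have hlim := hu.tendsto_pohozaev hd 0
  simp only [fderiv_fun_const, Pi.zero_apply, zero_apply, mul_zero, integral_zero,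
    integral_const_mul] at hlim
  have h : finrank ℝ E * (2 / (F * S)) / 2 * (F * V) ^ 2 - finrank ℝ E * (F * V) = 0 :=
    tendsto_nhds_unique hlim tendsto_const_nhds
  have h' : finrank ℝ E * F * V / S * (V - S) = 0 := by
    rw [← h]
    field_simp
  exact sub_eq_zero.1 ((mul_eq_zero.1 h').resolve_left (by positivity))

theorem IsLogSolution.volume_comparison_of_integrable (hd : 2 ≤ finrank ℝ E) (hF : 0 < F)
    (hS : 0 < S) (hu : IsLogSolution μ (2 / (F * S)) (finrank ℝ E) (fun x => F + φ x) u)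
    (h0 : ∀ x, φ x ≤ 0) (hV : Integrable (fun x => Real.exp (finrank ℝ E * u x)) μ)
    {k : ℕ} (hk : HasConeGrowth (fun x => 1 - φ x) k)
    (hp : k < finrank ℝ E → ∃ p, EulerInequality k φ p) :
    S ≤ ∫ x, Real.exp (finrank ℝ E * u x) ∂μ ∧
      (∫ x, Real.exp (finrank ℝ E * u x) ∂μ = S ↔ φ = 0) := by
  have hφ : Continuous φ := hu.continuous_of_const_add
  have hi := hu.integrable_mul_exp_of_const_add hV
  have hw : Integrable (fun x => (1 - φ x) * Real.exp (finrank ℝ E * u x)) μ := by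
    simpa only [sub_mul, one_mul, Pi.sub_def] using hV.sub hi
  have hdecay := hu.finrank_add_le hd (fun x => by linarith [h0 x]) hw hk
  set V := ∫ x, Real.exp (finrank ℝ E * u x) ∂μ
  set P := ∫ x, φ x * Real.exp (finrank ℝ E * u x) ∂μ
  have hΛ : ∫ x, (F + φ x) * Real.exp (finrank ℝ E * u x) ∂μ = F * V + P := by
    simp only [add_mul]
    rw [integral_add (hV.const_mul F) hi, integral_const_mul]
  have hP : P ≤ 0 := integral_nonpos fun x =>
    mul_nonpos_of_nonpos_of_nonneg (h0 x) (Real.exp_pos _).le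
  obtain ⟨t, ht⟩ : ∃ t, t * (F * S) = F * V + P := ⟨_, div_mul_cancel₀ _ (by positivity)⟩
  rw [hΛ, ← ht, show ∀ N : ℝ, N * (2 / (F * S) * (t * (F * S))) = 2 * N * t from
    fun N => by field_simp] at hdecay
  have hlt (ht1 : t < 1) : S < V := by
    have hkN : k < finrank ℝ E := by
      have : (0 : ℝ) < finrank ℝ E := by positivity
      exact_mod_cast (by nlinarith : (k : ℝ) < finrank ℝ E)
    obtain ⟨p, hp⟩ := hp hkN
    exact lt_of_mul_lt_mul_left (lt_of_pohozaev k.cast_nonneg (by positivity) ht hdecay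
      (by positivity) ht1 (hu.pohozaev_normalised_le hd hF hS hi (ht.trans hΛ.symm) hp)) hF.le
  have hle (ht1 : 1 ≤ t) : F * S ≤ F * V + P := ht ▸ le_mul_of_one_le_left (by positivity) ht1
  refine ⟨(lt_or_ge t 1).elim (fun h => (hlt h).le) fun h =>
    le_of_mul_le_mul_left (by linarith [hle h]) hF, fun hVS => ?_, ?_⟩
  · have hPS := hle (not_lt.1 fun h => (hlt h).ne' hVS)
    rw [hVS] at hPS
    exact eq_zero_of_integral_mul_exp_eq_zero hφ (continuous_const.mul hu.contDiff.continuous) h0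
      hi (hP.antisymm (by linarith))
  · rintro rfl
    exact IsLogSolution.integral_exp_eq hd hF hS (by simpa using hu)

theorem IsLogSolution.volume_comparison (hd : 2 ≤ finrank ℝ E) (hF : 0 < F) {S : ENNReal}
    (hS0 : S ≠ 0) (hS : S ≠ ⊤)
    (hu : IsLogSolution μ (2 / (F * S.toReal)) (finrank ℝ E) (fun x => F + φ x) u)
    (h0 : ∀ x, φ x ≤ 0) {k : ℕ} (hk : HasConeGrowth (fun x => 1 - φ x) k)
    (hp : k < finrank ℝ E → ∃ p, EulerInequality k φ p) :
    S ≤ ∫⁻ x, ENNReal.ofReal (Real.exp (finrank ℝ E * u x)) ∂μ ∧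
      (∫⁻ x, ENNReal.ofReal (Real.exp (finrank ℝ E * u x)) ∂μ = S ↔ φ = 0) := by
  have hnonneg : 0 ≤ᵐ[μ] fun x => Real.exp (finrank ℝ E * u x) :=
    ae_of_all _ fun x => (Real.exp_pos _).le
  by_cases hV : Integrable (fun x => Real.exp (finrank ℝ E * u x)) μ
  · rw [← ofReal_integral_eq_lintegral_ofReal hV hnonneg, ← ENNReal.ofReal_toReal hS,
      ENNReal.ofReal_eq_ofReal_iff (integral_nonneg_of_ae hnonneg) ENNReal.toReal_nonneg,
      ENNReal.ofReal_le_ofReal_iff (integral_nonneg_of_ae hnonneg)]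
    exact hu.volume_comparison_of_integrable hd hF (ENNReal.toReal_pos hS0 hS) h0 hV hk hp
  · have htop : ∫⁻ x, ENNReal.ofReal (Real.exp (finrank ℝ E * u x)) ∂μ = ⊤ := by
      rwa [← lintegral_ofReal_ne_top_iff_integrable
        hu.contDiff_exp.continuous.aestronglyMeasurable hnonneg, not_ne_iff] at hV
    rw [htop]
    refine ⟨le_top, fun h => absurd h.symm hS, ?_⟩
    rintro rfl
    exact absurd ((integrable_const_mul_iff hF.ne'.isUnit _).1 (by simpa using hu.integrable)) hV

end VolumeComparison

/-! ### Nonpositive polynomials -/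

section Centre

lemma EulerInequality.of_comp {E E' : Type*} [NormedAddCommGroup E] [NormedSpace ℝ E]
    [NormedAddCommGroup E'] [NormedSpace ℝ E'] {f : E' → ℝ} (hf : Differentiable ℝ f)
    {T : E →ᴬ[ℝ] E'} (hT : Function.Surjective T) {d : ℝ} {p : E}
    (h : EulerInequality d (f ∘ T) p) : EulerInequality d f (T p) := by
  intro y
  obtain ⟨x, rfl⟩ := hT y
  have hx := h x
  rw [fderiv_comp _ (hf _) T.differentiableAt, T.fderiv] at hx
  simpa [← vsub_eq_sub, T.contLinear_map_vsub] using hx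

variable {E : Type*} [NormedAddCommGroup E] [InnerProductSpace ℝ E]

/-- `f` is a polynomial function of degree at most two, written in terms of a linear map. -/
def IsQuadraticFun (f : E → ℝ) : Prop :=
  ∃ (A : E →ₗ[ℝ] E) (b : E) (c : ℝ), ∀ x, f x = inner ℝ (A x) x + inner ℝ b x + c

lemma isQuadraticFun_const (c : ℝ) : IsQuadraticFun fun _ : E => c :=
  ⟨0, 0, c, fun x => by simp⟩

lemma isQuadraticFun_inner (b : E) : IsQuadraticFun fun x => inner ℝ b x :=
  ⟨0, b, 0, fun x => by simp⟩

lemma isQuadraticFun_inner_mul_inner (a b : E) :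
    IsQuadraticFun fun x => inner ℝ a x * inner ℝ b x :=
  ⟨(innerₗ E a).smulRight b, 0, 0, fun x => by simp [inner_smul_left]⟩

lemma IsQuadraticFun.add {f g : E → ℝ} (hf : IsQuadraticFun f) (hg : IsQuadraticFun g) :
    IsQuadraticFun (f + g) := by
  obtain ⟨A, b, c, hf⟩ := hf
  obtain ⟨A', b', c', hg⟩ := hg
  refine ⟨A + A', b + b', c + c', fun x => ?_⟩
  simp only [Pi.add_apply, hf, hg, LinearMap.add_apply, inner_add_left]
  ring

lemma IsQuadraticFun.const_mul {f : E → ℝ} (hf : IsQuadraticFun f) (r : ℝ) :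
    IsQuadraticFun fun x => r * f x := by
  obtain ⟨A, b, c, hf⟩ := hf
  refine ⟨r • A, r • b, r * c, fun x => ?_⟩
  simp only [hf, LinearMap.smul_apply, real_inner_smul_left]
  ring

variable [FiniteDimensional ℝ E]

lemma IsQuadraticFun.exists_isSymmetric {f : E → ℝ} (hf : IsQuadraticFun f) :
    ∃ (A : E →ₗ[ℝ] E) (b : E) (c : ℝ), A.IsSymmetric ∧
      ∀ x, f x = inner ℝ (A x) x + inner ℝ b x + c := by
  obtain ⟨A, b, c, hf⟩ := hf
  refine ⟨(2⁻¹ : ℝ) • (A + A.adjoint), b, c, fun x y => ?_, fun x => ?_⟩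
  · simp only [LinearMap.smul_apply, LinearMap.add_apply, real_inner_smul_left,
      real_inner_smul_right, inner_add_left, inner_add_right, LinearMap.adjoint_inner_left,
      LinearMap.adjoint_inner_right]
    ring
  · simp only [hf, LinearMap.smul_apply, LinearMap.add_apply, real_inner_smul_left,
      inner_add_left, LinearMap.adjoint_inner_left, real_inner_comm x (A x)]
    ring

lemma mem_range_of_quadratic_nonpos {A : E →ₗ[ℝ] E} (hA : A.IsSymmetric) {b : E} {c : ℝ}
    (h0 : ∀ x, inner ℝ (A x) x + inner ℝ b x + c ≤ 0) : b ∈ A.range := by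
  rw [← A.range.orthogonal_orthogonal, hA.orthogonal_range, Submodule.mem_orthogonal']
  intro x hx
  by_contra hbx
  have hline := h0 (((1 - c) / inner ℝ b x) • x)
  rw [map_smul, LinearMap.mem_ker.1 hx, smul_zero, inner_zero_left, real_inner_smul_right,
    div_mul_cancel₀ _ hbx] at hline
  linarith

lemma IsQuadraticFun.exists_eulerInequality {f : E → ℝ} (hf : IsQuadraticFun f)
    (h0 : ∀ x, f x ≤ 0) : ∃ p, EulerInequality 2 f p := by
  obtain ⟨A, b, c, hA, hf⟩ := hf.exists_isSymmetric
  obtain ⟨p, rfl⟩ := mem_range_of_quadratic_nonpos hA fun x => hf x ▸ h0 x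
  have hfp := h0 ((-2⁻¹ : ℝ) • p)
  refine ⟨(-2⁻¹ : ℝ) • p, fun z => ?_⟩
  have hderiv : HasFDerivAt f ((2 : ℝ) • innerSL ℝ (A z) + innerSL ℝ (A p)) z := by
    rw [funext hf]
    convert! ((A.toContinuousLinearMap.hasFDerivAt.inner ℝ (hasFDerivAt_id z)).add
      (innerSL ℝ (A p)).hasFDerivAt).add_const c using 1
    ext v
    simp [hA v z, real_inner_comm v, two_mul]
  rw [hf] at hfp
  rw [hderiv.fderiv, hf]
  simp only [add_apply, smul_apply, innerSL_apply_apply, map_smul, real_inner_smul_left,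
    real_inner_smul_right, inner_sub_right, smul_eq_mul, hA z p, real_inner_comm (A p) z] at hfp ⊢
  linarith

end Centre

section Polynomials

variable {n : ℕ} {φ : MvPolynomial (Fin n) ℝ}

lemma contDiff_polyFun (p : MvPolynomial (Fin n) ℝ) {k : ℕ∞ω} : ContDiff ℝ k (polyFun p) :=
  (AnalyticOnNhd.eval_continuousLinearMap
    (EuclideanSpace.equiv (Fin n) ℝ : Euc n →L[ℝ] Fin n → ℝ) p).contDiff

lemma polyFun_eq_zero_iff {p : MvPolynomial (Fin n) ℝ} : polyFun p = 0 ↔ p = 0 := by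
  refine ⟨fun h => MvPolynomial.funext fun x => ?_, ?_⟩
  · simpa [polyFun] using congrFun h (WithLp.toLp 2 x)
  · rintro rfl
    ext x
    simp [polyFun]

lemma polyFun_sum {ι : Type*} (s : Finset ι) (p : ι → MvPolynomial (Fin n) ℝ) :
    polyFun (∑ i ∈ s, p i) = ∑ i ∈ s, polyFun (p i) := by
  ext x
  simp [polyFun]

lemma HomogeneityCondition.exists_eulerInequality (h : HomogeneityCondition φ) :
    ∃ p, EulerInequality φ.totalDegree (polyFun φ) p := by
  obtain ⟨T, hT⟩ := h
  refine ⟨T 0, .of_comp ((contDiff_polyFun φ).differentiable one_ne_zero)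
    (T := T.toAffineIsometry.toContinuousAffineMap) T.surjective fun x => ?_⟩
  rw [sub_zero]
  exact (hT x).trans_eq inner_gradient_right

lemma isQuadraticFun_monomial {m : Fin n →₀ ℕ} (hm : m.toMultiset.card ≤ 2) (a : ℝ) :
    IsQuadraticFun (polyFun (MvPolynomial.monomial m a)) := by
  have hcoord (i : Fin n) (x : Euc n) : x i = inner ℝ (EuclideanSpace.single i 1) x := by
    simp [EuclideanSpace.inner_single_left]
  obtain ⟨s, rfl⟩ := Multiset.toFinsupp.surjective m
  rw [Multiset.toFinsupp_toMultiset] at hm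
  have heval (x : Euc n) :
      polyFun (MvPolynomial.monomial s.toFinsupp a) x = a * (s.map fun i => x i).prod := by
    rw [polyFun, MvPolynomial.eval_monomial, Finset.prod_multiset_map_count]
    rfl
  rw [funext heval]
  apply IsQuadraticFun.const_mul
  interval_cases hs : s.card
  · simpa [Multiset.card_eq_zero.1 hs] using isQuadraticFun_const 1
  · obtain ⟨i, rfl⟩ := Multiset.card_eq_one.1 hs
    simpa [hcoord] using isQuadraticFun_inner (EuclideanSpace.single i (1 : ℝ))
  · obtain ⟨i, j, rfl⟩ := Multiset.card_eq_two.1 hs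
    simpa [hcoord] using isQuadraticFun_inner_mul_inner (EuclideanSpace.single i (1 : ℝ))
      (EuclideanSpace.single j 1)

lemma isQuadraticFun_polyFun {p : MvPolynomial (Fin n) ℝ} (hp : p.totalDegree ≤ 2) :
    IsQuadraticFun (polyFun p) := by
  rw [p.as_sum, polyFun_sum]
  refine Finset.sum_induction _ IsQuadraticFun (fun _ _ => .add) (isQuadraticFun_const 0)
    fun m hm => isQuadraticFun_monomial ?_ _
  rw [MvPolynomial.totalDegree_eq] at hp
  exact (Finset.le_sup (f := fun m : Fin n →₀ ℕ => m.toMultiset.card) hm).trans hp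

/-- The homogenisation of `p` with respect to an additional variable `s`. -/
noncomputable def homogenization (p : MvPolynomial (Fin n) ℝ) (s : ℝ) (x : Euc n) : ℝ :=
  ∑ i ∈ Finset.range (p.totalDegree + 1),
    s ^ (p.totalDegree - i) * polyFun (MvPolynomial.homogeneousComponent i p) x

lemma continuous_homogenization (p : MvPolynomial (Fin n) ℝ) :
    Continuous fun q : ℝ × Euc n => homogenization p q.1 q.2 :=
  continuous_finsetSum _ fun _ _ => (continuous_fst.pow _).mul
    ((contDiff_polyFun (k := 0) _).continuous.comp continuous_snd)

lemma homogenization_zero (p : MvPolynomial (Fin n) ℝ) (x : Euc n) :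
    homogenization p 0 x = polyFun (MvPolynomial.homogeneousComponent p.totalDegree p) x := by
  rw [homogenization, Finset.sum_range_succ, Finset.sum_eq_zero fun i hi => ?_]
  · simp
  · rw [zero_pow (Nat.sub_ne_zero_of_lt (Finset.mem_range.1 hi)), zero_mul]

lemma polyFun_smul_of_isHomogeneous {p : MvPolynomial (Fin n) ℝ} {d : ℕ} (hp : p.IsHomogeneous d)
    (r : ℝ) (x : Euc n) : polyFun p (r • x) = r ^ d * polyFun p x := by
  rw [polyFun, polyFun, MvPolynomial.eval_eq, MvPolynomial.eval_eq, Finset.mul_sum]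
  refine Finset.sum_congr rfl fun m hm => ?_
  simp only [PiLp.smul_apply, smul_eq_mul, mul_pow, Finset.prod_mul_distrib,
    Finset.prod_pow_eq_pow_sum, hp.degree_eq_sum_deg_support hm]
  ring

lemma polyFun_smul (p : MvPolynomial (Fin n) ℝ) {r : ℝ} (hr : r ≠ 0) (x : Euc n) :
    polyFun p (r • x) = r ^ p.totalDegree * homogenization p r⁻¹ x := by
  conv_lhs => rw [← p.sum_homogeneousComponent]
  rw [polyFun_sum, Finset.sum_apply, homogenization, Finset.mul_sum]
  refine Finset.sum_congr rfl fun i hi => ?_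
  rw [polyFun_smul_of_isHomogeneous (MvPolynomial.homogeneousComponent_isHomogeneous i p),
    ← mul_assoc, inv_pow, pow_sub₀ _ hr (Finset.mem_range_succ_iff.1 hi)]
  field_simp

lemma homogeneousComponent_totalDegree_ne_zero (hφ : φ ≠ 0) :
    MvPolynomial.homogeneousComponent φ.totalDegree φ ≠ 0 := by
  obtain ⟨m, hm, hdeg⟩ := Finset.exists_mem_eq_sup φ.support
    (MvPolynomial.support_nonempty.2 hφ) (fun s => s.sum fun _ e => e)
  refine MvPolynomial.ne_zero_iff.2 ⟨m, ?_⟩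
  rw [MvPolynomial.coeff_homogeneousComponent, if_pos (by rw [MvPolynomial.totalDegree, hdeg]; rfl)]
  exact MvPolynomial.mem_support_iff.1 hm

lemma homogenization_zero_nonpos (h0 : ∀ x, polyFun φ x ≤ 0) (x : Euc n) :
    homogenization φ 0 x ≤ 0 := by
  have hcont : Continuous fun s => homogenization φ s x :=
    (continuous_homogenization φ).comp (continuous_id.prodMk continuous_const)
  refine le_of_tendsto ((hcont.tendsto 0).mono_left (nhdsWithin_le_nhds (s := Set.Ioi 0))) ?_
  filter_upwards [self_mem_nhdsWithin] with s hs
  have hs' : 0 < s⁻¹ := inv_pos.2 hs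
  have h := h0 (s⁻¹ • x)
  rw [polyFun_smul φ hs'.ne', inv_inv] at h
  exact nonpos_of_mul_nonpos_right h (pow_pos hs' _)

lemma exists_homogenization_zero_neg (h0 : ∀ x, polyFun φ x ≤ 0) (hφ : φ ≠ 0) :
    ∃ q : Euc n, homogenization φ 0 q < 0 := by
  by_contra! h
  refine homogeneousComponent_totalDegree_ne_zero hφ (polyFun_eq_zero_iff.1 (funext fun x => ?_))
  rw [← homogenization_zero]
  exact (homogenization_zero_nonpos h0 x).antisymm (h x)

lemma even_totalDegree_of_nonpos (h0 : ∀ x, polyFun φ x ≤ 0) : Even φ.totalDegree := by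
  by_cases hφ : φ = 0
  · simp [hφ]
  by_contra hodd
  obtain ⟨q, hq⟩ := exists_homogenization_zero_neg h0 hφ
  have hneg := homogenization_zero_nonpos h0 ((-1 : ℝ) • q)
  rw [homogenization_zero, polyFun_smul_of_isHomogeneous
    (MvPolynomial.homogeneousComponent_isHomogeneous _ φ), ← homogenization_zero,
    (Nat.not_even_iff_odd.1 hodd).neg_one_pow] at hneg
  linarith

lemma hasConeGrowth_one_sub_polyFun (h0 : ∀ x, polyFun φ x ≤ 0) :
    HasConeGrowth (fun x => 1 - polyFun φ x) φ.totalDegree := by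
  by_cases hφ : φ = 0
  · exact ⟨0, 1, one_pos, 1, one_pos, Eventually.of_forall fun R z _ => by simp [hφ, polyFun]⟩
  obtain ⟨q, hq⟩ := exists_homogenization_zero_neg h0 hφ
  have hnear : ∀ᶠ a in 𝓝 0 ×ˢ 𝓝 q, homogenization φ a.1 a.2 < homogenization φ 0 q / 2 := by
    rw [← nhds_prod_eq]
    exact (continuous_homogenization φ).continuousAt.eventually_lt_const (by
      simpa using by linarith)
  obtain ⟨_, hs, _, hx, hsx⟩ := eventually_prod_iff.1 hnear
  obtain ⟨ρ, hρ, hball⟩ := nhds_basis_closedBall.eventually_iff.1 hx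
  refine ⟨q, ρ, hρ, -(homogenization φ 0 q / 2), by linarith, ?_⟩
  filter_upwards [tendsto_inv_atTop_zero.eventually hs, eventually_gt_atTop 0] with R hsR hR z hz
  have hle := mul_le_mul_of_nonneg_left (hsx hsR (hball hz)).le (pow_nonneg hR.le φ.totalDegree)
  rw [polyFun_smul φ hR.ne']
  linarith

lemma exists_eulerInequality_of_nonpos (h0 : ∀ x, polyFun φ x ≤ 0)
    (hφ : 4 ≤ φ.totalDegree → HomogeneityCondition φ) :
    ∃ p, EulerInequality φ.totalDegree (polyFun φ) p := by
  rcases le_or_gt 4 φ.totalDegree with h4 | h4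
  · exact (hφ h4).exists_eulerInequality
  have heven := even_totalDegree_of_nonpos h0
  interval_cases hdeg : φ.totalDegree
  · rw [MvPolynomial.totalDegree_eq_zero_iff_eq_C] at hdeg
    have hconst : polyFun φ = fun _ : Euc n => φ.coeff 0 := by
      ext x
      rw [hdeg]
      simp [polyFun]
    exact ⟨0, fun x => by simp [hconst]⟩
  · exact absurd heven (by decide)
  · exact_mod_cast (isQuadraticFun_polyFun hdeg.le).exists_eulerInequality h0
  · exact absurd heven (by decide)

end Polynomials

section SphereVolume

variable {n : ℕ}

lemma sphereVol_ne_top : sphereVol n ≠ ⊤ := measure_ne_top _ _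

lemma sphereVol_ne_zero : sphereVol n ≠ 0 := by
  rw [sphereVol, Measure.toSphere_apply_univ, finrank_euclideanSpace_fin]
  exact mul_ne_zero (by simp) (measure_ball_pos _ _ one_pos).ne'

lemma IsNormalSolution.isLogSolution {Q u : Euc n → ℝ} (hu : IsNormalSolution n Q u) :
    IsLogSolution volume (2 / ((Nat.factorial (n - 1) : ℝ) * (sphereVol n).toReal)) n Q u where
  contDiff_curvature := hu.smooth_curvature.of_le (by simp)
  contDiff := hu.smooth.of_le (by simp)
  integrable := hu.integrable
  exists_const := hu.normal

end SphereVolume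

end QCurvature

open QCurvature in
theorem theorem1p3_general {n : ℕ} (hn : 2 ≤ n) {φ : MvPolynomial (Fin n) ℝ}
    (hφ_nonpos : ∀ x : Euc n, polyFun φ x ≤ 0)
    (hφ_hom : 4 ≤ φ.totalDegree → φ.totalDegree < n → HomogeneityCondition φ)
    {F : ℝ} (hF : 0 < F) {S : ENNReal} (hS0 : S ≠ 0) (hS : S ≠ ⊤) {u : Euc n → ℝ}
    (hu : IsLogSolution volume (2 / (F * S.toReal)) n (fun x => F + polyFun φ x) u) :
    S ≤ ∫⁻ x, ENNReal.ofReal (Real.exp (n * u x)) ∧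
      (∫⁻ x, ENNReal.ofReal (Real.exp (n * u x)) = S ↔ φ = 0) := by
  have hdim : Module.finrank ℝ (Euc n) = n := finrank_euclideanSpace_fin
  have hcast : (n : ℝ) = Module.finrank ℝ (Euc n) := congrArg _ hdim.symm
  rw [hcast] at hu ⊢
  rw [← polyFun_eq_zero_iff]
  exact hu.volume_comparison (hn.trans_eq hdim.symm) hF hS0 hS hφ_nonpos
    (hasConeGrowth_one_sub_polyFun hφ_nonpos) fun hlt =>
      exists_eulerInequality_of_nonpos hφ_nonpos fun h4 => hφ_hom h4 (hlt.trans_eq hdim)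

theorem theorem1p3 (n : ℕ) (hn : 6 ≤ n) (hn_even : Even n)
    (φ : MvPolynomial (Fin n) ℝ)
    (hφ_nonpos : ∀ x : QCurvature.Euc n, QCurvature.polyFun φ x ≤ 0)
    (hφ_hom : 4 ≤ φ.totalDegree → φ.totalDegree ≤ n - 2 → QCurvature.HomogeneityCondition φ)
    (u : QCurvature.Euc n → ℝ)
    (hu : QCurvature.IsNormalSolution n (fun x => (Nat.factorial (n - 1) : ℝ) + QCurvature.polyFun φ x) u) :
    QCurvature.sphereVol n ≤ ∫⁻ x, ENNReal.ofReal (Real.exp (n * u x)) ∧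
      (∫⁻ x, ENNReal.ofReal (Real.exp (n * u x)) = QCurvature.sphereVol n ↔ φ = 0) := by
  have hdeg := QCurvature.even_totalDegree_of_nonpos hφ_nonpos
  exact theorem1p3_general (by lia) hφ_nonpos (fun h4 hlt => hφ_hom h4 (by grind)) (by positivity)
    QCurvature.sphereVol_ne_zero QCurvature.sphereVol_ne_top hu.isLogSolution
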